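/- Let $\ell\ge 1$ be an integer, $0<p<q=1-p$ and $\rho=p/q$. Let $\mathcal{P}_\ell$ be the transition matrix of the Markov chain $(S_t,\varphi_t)$ on $\{0,1,2,\dots\}\times\{1,\dots,2\ell\}$ in which the phase moves cyclically, $1\to2\to\cdots\to2\ell\to1$, and, while the phase is $i$: if $i\le\ell$ (red light), the queue length increases by $1$ with probability $p$ and is unchanged with probability $q$; if $i>\ell$ (green light), it is unchanged with probability $p$ and decreases by $1$ (or stays at $0$ if it is $0$) with probability $q$. Let $\mathcal{A}_{-1},\mathcal{A}_0,\mathcal{A}_1$ be the $2\ell\times2\ell$ matrices of the transition probabilities from a level (queue length) $n\ge1$ to the levels $n-1$, $n$, $n+1$. The chain has a unique stationary probability vector $(\gamma_{k,i})$; let $\widehat\pi_k=\sum_{i=1}^{2\ell}\gamma_{k,i}$ be the stationary probability that $k$ cars are waiting. Let $\widehat R$ be the rate matrix, that is, the unique entrywise non-negative matrix with all its eigenvalues in the open unit disk such that $\widehat R^2\mathcal{A}_{-1}+\widehat R(\mathcal{A}_0-I)+\mathcal{A}_1=0$. For $1\le j\le\ell$ let $\sigma_j,\mu_j\in\mathbb{C}$,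 with $|\sigma_j|\le|\mu_j|$, be the two roots of $(pz+q)^2-e^{2\pi \mathrm{i}(j-1)/\ell}z$. Then $\rho^2$ is an eigenvalue of $\widehat R$; it is simple (of algebraic multiplicity one), and all the other eigenvalues are strictly smaller than $\rho^2$ in modulus. The vector $$\widehat u=(\rho^\ell,\rho^{\ell-1},\dots,\rho,1,\rho,\dots,\rho^{\ell-1})^{T}$$ is a left eigenvector of $\widehat R$ for $\rho^2$. Counted with algebraic multiplicity, the eigenvalues of $\widehat R$ are $0$, repeated $\ell$ times, and $1/\mu_1,\dots,1/\mu_\ell$. Finally, if $\widehat v$ denotes the unique right eigenvector of $\widehat R$ for $\rho^2$ with $\widehat u^{T}\widehat v=1$, and $\mathbf 1$ the vector of ones, then, as $k\to\infty$, $$\widehat\pi_k=\widehat c(\ell,p)\,\rho^{2k}+o(\rho^{2k}),\qquad \widehat c(\ell,p)=\frac{1-\rho^2}{2\ell}\,(\widehat v^{T}\mathbf 1)(\widehat u^{T}\mathbf 1).$$ -/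

import Mathlib

open Filter Asymptotics Matrix
open scoped Topology Polynomial

noncomputable section

namespace TrafficLight

/-- Phases of the traffic light, counted from `0`: red for `i < ℓ`, green for `ℓ ≤ i < 2ℓ`. -/
abbrev Phase (ℓ : ℕ) : Type := Fin (2 * ℓ)

/-- The phase after `i` is `j`, cyclically. -/
def Follows {ℓ : ℕ} (i j : Phase ℓ) : Prop := (j : ℕ) = ((i : ℕ) + 1) % (2 * ℓ)

open Classical in
/-- One level down: the light is green and no car arrives. -/
def blockDown (ℓ : ℕ) (p : ℝ) : Matrix (Phase ℓ) (Phase ℓ) ℝ :=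
  Matrix.of fun i j => if Follows i j then (if (i : ℕ) < ℓ then 0 else 1 - p) else 0

open Classical in
/-- Same level (from a level `≥ 1`): red and no arrival, or green and an arrival. -/
def blockStay (ℓ : ℕ) (p : ℝ) : Matrix (Phase ℓ) (Phase ℓ) ℝ :=
  Matrix.of fun i j => if Follows i j then (if (i : ℕ) < ℓ then 1 - p else p) else 0

open Classical in
/-- One level up: the light is red and a car arrives. -/
def blockUp (ℓ : ℕ) (p : ℝ) : Matrix (Phase ℓ) (Phase ℓ) ℝ :=
  Matrix.of fun i j => if Follows i j then (if (i : ℕ) < ℓ then p else 0) else 0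

/-- From the empty queue to the empty queue. -/
def blockBoundary (ℓ : ℕ) (p : ℝ) : Matrix (Phase ℓ) (Phase ℓ) ℝ :=
  blockDown ℓ p + blockStay ℓ p

/-- States of the queue: number of waiting cars and phase of the light. -/
abbrev State (ℓ : ℕ) : Type := ℕ × Phase ℓ

/-- The (infinite, block tridiagonal) transition matrix of the detailed queue. -/
def transition (ℓ : ℕ) (p : ℝ) : Matrix (State ℓ) (State ℓ) ℝ :=
  Matrix.of fun s t =>
    if t.1 = s.1 + 1 then blockUp ℓ p s.2 t.2
    else if t.1 = s.1 then
      (if s.1 = 0 then blockBoundary ℓ p s.2 t.2 else blockStay ℓ p s.2 t.2)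
    else if t.1 + 1 = s.1 then blockDown ℓ p s.2 t.2
    else 0

/-- `γ` is a stationary probability vector of the detailed queue. -/
structure IsStationary (ℓ : ℕ) (p : ℝ) (γ : State ℓ → ℝ) : Prop where
  nonneg : ∀ s, 0 ≤ γ s
  total : HasSum γ 1
  invariant : ∀ t, HasSum (fun s => γ s * transition ℓ p s t) (γ t)

/-- Marginal probability that `k` cars are waiting. -/
def marginal {ℓ : ℕ} (γ : State ℓ → ℝ) (k : ℕ) : ℝ := ∑ i : Phase ℓ, γ (k, i)

/-- A real matrix regarded as a complex one. -/
abbrev toComplex {ℓ : ℕ} (R : Matrix (Phase ℓ) (Phase ℓ) ℝ) : Matrix (Phase ℓ) (Phase ℓ) ℂ :=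
  R.map (algebraMap ℝ ℂ)

/-- `R` is the rate matrix of the detailed queue: the non-negative solution, with all its
eigenvalues in the open unit disk, of `R² A₋₁ + R (A₀ - I) + A₁ = 0`. -/
structure IsRateMatrix (ℓ : ℕ) (p : ℝ) (R : Matrix (Phase ℓ) (Phase ℓ) ℝ) : Prop where
  nonneg : ∀ i j, 0 ≤ R i j
  equation : R ^ 2 * blockDown ℓ p + R * (blockStay ℓ p - 1) + blockUp ℓ p = 0
  eigenvalues : ∀ z ∈ spectrum ℂ (toComplex R), ‖z‖ < 1

/-- `ρ = p / q`, where `q = 1 - p`. -/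
def rho (p : ℝ) : ℝ := p / (1 - p)

/-- The vector `(ρ^ℓ, …, ρ, 1, ρ, …, ρ^(ℓ-1))`. -/
def uHat (ℓ : ℕ) (p : ℝ) : Phase ℓ → ℝ :=
  fun i => if (i : ℕ) < ℓ then rho p ^ (ℓ - (i : ℕ)) else rho p ^ ((i : ℕ) - ℓ)

/-- `v` is the right eigenvector of `R` for `ρ²`, normalised by `ûᵀ v = 1`. -/
def IsRightEigenvector (ℓ : ℕ) (p : ℝ) (R : Matrix (Phase ℓ) (Phase ℓ) ℝ)
    (v : Phase ℓ → ℝ) : Prop :=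
  R *ᵥ v = rho p ^ 2 • v ∧ uHat ℓ p ⬝ᵥ v = 1

/-- The quadratic polynomial `(p z + q)² - ω^j z`, where `ω = exp(2πi/ℓ)`. Here `j` runs over
`0, …, ℓ - 1`. -/
def quadratic (ℓ : ℕ) (p : ℝ) (j : Fin ℓ) : ℂ[X] :=
  (Polynomial.C (p : ℂ) * Polynomial.X + Polynomial.C ((1 - p : ℝ) : ℂ)) ^ 2
    - Polynomial.C (Complex.exp (2 * Real.pi * Complex.I / ℓ) ^ (j : ℕ)) * Polynomial.X

/-- For each `j`, `σ j` and `μ j` are the two roots (with multiplicity) of the `j`-th quadratic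
polynomial, the root `μ j` being the larger one in modulus. -/
def AreRoots (ℓ : ℕ) (p : ℝ) (σ μ : Fin ℓ → ℂ) : Prop :=
  ∀ j, (quadratic ℓ p j).roots = {σ j, μ j} ∧ ‖σ j‖ ≤ ‖μ j‖

end TrafficLight

end

noncomputable section

namespace TrafficLight

/-! Write q = 1 - p. Each block is a weighted cyclic shift, so the pencil z²A₋₁ + z(A₀ - I) + A₁ is
-z on the diagonal plus one cycle of weights, and its determinant has two terms: -z^ℓ((qz+p)^(2ℓ) -
z^ℓ) = -z^ℓ ∏ⱼ ((qz+p)² - ω^j z). Its roots are 0 (ℓ times), the 1/μⱼ and the 1/σⱼ (`det_pencil`,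
`AreRoots.reversed`). The triangle inequality in |z| = |qz+p|² gives |1/μⱼ| ≤ ρ² and |1/σⱼ| ≥ 1, and
|z| = ρ² forces z = ρ². Since zI - R is a left factor of the pencil, the characteristic polynomial
of a rate matrix collects exactly the 2ℓ roots in the open disk (`charpoly_roots`).

For z ≠ 0 a left null vector of the pencil is determined by one entry and does not involve R.
Together with the coordinate vectors of the green phases, the null vectors at the 1/μⱼ form a basis
that diagonalises every rate matrix (`exists_diagonalisation`). Uniqueness of R, the eigenvectors û
and v, and the decay of R^k on the hyperplane orthogonal to û all follow. Existence comes from a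
monotone iteration started at 0, whose limit has spectral radius at most ρ² because û is
subinvariant (`exists_rateMatrix`).

At z = 1 the pencil is a cyclic permutation matrix minus I, whence 1ᵀ(I - R)R^k/(2ℓ) is stationary.
Conversely the defect γ_{k+1} - γ_k R of any stationary vector vanishes (`eq_zero_of_recursion`).
Splitting the vector of ones along v and the hyperplane orthogonal to û then yields the constant in
the asymptotics. -/

/-! ### Weighted cyclic matrices -/

/-- The phase following a given one. -/
def next (ℓ : ℕ) : Equiv.Perm (Phase ℓ) := finRotate (2 * ℓ)

/-- The matrix whose only non-zero entries are `c i`, at the places `(i, next i)`. -/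
def cyclic {ℓ : ℕ} {K : Type*} [Zero K] (c : Phase ℓ → K) : Matrix (Phase ℓ) (Phase ℓ) K :=
  Matrix.of fun i j => if next ℓ i = j then c i else 0

section Cyclic

variable {ℓ : ℕ}

lemma coe_next (i : Phase ℓ) : (next ℓ i : ℕ) = ((i : ℕ) + 1) % (2 * ℓ) := by
  have := i.neZero
  rw [next, finRotate_apply, Fin.val_add]
  simp

lemma next_of_lt {n : ℕ} (h : n + 1 < 2 * ℓ) :
    next ℓ ⟨n, (Nat.lt_succ_self n).trans h⟩ = ⟨n + 1, h⟩ := by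
  ext
  rw [coe_next]
  exact Nat.mod_eq_of_lt h

lemma follows_iff {i j : Phase ℓ} : Follows i j ↔ next ℓ i = j := by
  rw [Follows, ← coe_next, Fin.ext_iff, eq_comm]

lemma next_ne (i : Phase ℓ) : next ℓ i ≠ i := by
  intro h
  have h1 := congrArg Fin.val h
  rw [coe_next] at h1
  have hi := i.2
  rcases Nat.lt_or_ge ((i : ℕ) + 1) (2 * ℓ) with h2 | h2
  · rw [Nat.mod_eq_of_lt h2] at h1; omega
  · have h3 : (i : ℕ) + 1 = 2 * ℓ := by omega
    rw [h3, Nat.mod_self] at h1; omega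

/-- A property stable under `next` that holds somewhere holds everywhere. -/
lemma forall_of_next {P : Phase ℓ → Prop} (hP : ∀ i, P i → P (next ℓ i)) {i₀ : Phase ℓ}
    (h₀ : P i₀) (i : Phase ℓ) : P i := by
  have hup : ∀ (d m : ℕ) (hm : m + d < 2 * ℓ), P ⟨m, by omega⟩ → P ⟨m + d, hm⟩ := by
    intro d
    induction d with
    | zero => intro m hm h; exact h
    | succ d ih =>
      intro m hm h
      have h2 := hP _ (ih m (by omega) h)
      rwa [next_of_lt (by omega)] at h2
  have hi₀ := i₀.2
  have hi := i.2
  have hlast : P ⟨2 * ℓ - 1, by omega⟩ := by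
    have := hup (2 * ℓ - 1 - i₀) i₀ (by omega) h₀
    convert this using 2
    omega
  have hzero : P ⟨0, by omega⟩ := by
    have h := hP _ hlast
    have h2 : next ℓ ⟨2 * ℓ - 1, by omega⟩ = ⟨0, by omega⟩ := by
      ext
      rw [coe_next]
      simp only
      rw [Nat.sub_add_cancel (by omega), Nat.mod_self]
    rwa [h2] at h
  have := hup i 0 (by omega) hzero
  convert this using 1
  ext
  simp

lemma sign_next (hℓ : 1 ≤ ℓ) : Equiv.Perm.sign (next ℓ) = -1 := by
  rw [next, sign_finRotate]
  exact Odd.neg_one_pow ⟨ℓ - 1, by omega⟩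

variable {K : Type*} [CommRing K]

lemma vecMul_cyclic (x c : Phase ℓ → K) (i : Phase ℓ) :
    (x ᵥ* cyclic c) (next ℓ i) = x i * c i := by
  simp [vecMul, dotProduct, cyclic]

lemma cyclic_mulVec_one (c : Phase ℓ → K) : cyclic c *ᵥ 1 = c := by
  ext i
  simp [mulVec, dotProduct, cyclic]

lemma cyclic_add (c d : Phase ℓ → K) : cyclic c + cyclic d = cyclic (c + d) := by
  ext i j
  by_cases h : next ℓ i = j <;> simp [cyclic, h]

lemma smul_cyclic (a : K) (c : Phase ℓ → K) : a • cyclic c = cyclic (a • c) := by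
  ext i j
  by_cases h : next ℓ i = j <;> simp [cyclic, h]

lemma map_cyclic {L : Type*} [CommRing L] (f : K →+* L) (c : Phase ℓ → K) :
    (cyclic c).map f = cyclic (fun i => f (c i)) := by
  ext i j
  by_cases h : next ℓ i = j <;> simp [cyclic, h]

/-- In a non-zero term of the Leibniz formula, σ fixes each phase or moves it one step back. By
injectivity a single fixed phase forces the next one to be fixed, so only two permutations survive.
The minus sign is that of a cycle of even length 2ℓ. -/
lemma det_diagonal_add_cyclic (hℓ : 1 ≤ ℓ) (a c : Phase ℓ → K) :
    (diagonal a + cyclic c).det = ∏ i, a i - ∏ i, c i := by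
  rw [det_apply']
  have hne : (1 : Equiv.Perm (Phase ℓ)) ≠ (next ℓ).symm := by
    intro h
    have h1 := congrArg (fun σ : Equiv.Perm (Phase ℓ) => σ (next ℓ ⟨0, by omega⟩)) h
    simp only [Equiv.Perm.one_apply, Equiv.symm_apply_apply] at h1
    exact next_ne _ h1
  rw [← Finset.sum_subset (Finset.subset_univ {1, (next ℓ).symm}), Finset.sum_pair hne]
  · have h1 : ∀ i, (diagonal a + cyclic c) ((1 : Equiv.Perm (Phase ℓ)) i) i = a i := by
      intro i
      simp [cyclic, next_ne]
    have h2 : ∀ i, (diagonal a + cyclic c) ((next ℓ).symm i) i = c ((next ℓ).symm i) := by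
      intro i
      have : (next ℓ).symm i ≠ i := fun h => next_ne i (by nth_rewrite 1 [← h]; simp)
      rw [Matrix.add_apply, diagonal_apply_ne _ this]
      simp [cyclic]
    simp only [h1, h2]
    rw [Equiv.prod_comp (next ℓ).symm c, Equiv.Perm.sign_symm, sign_next hℓ]
    simp [sub_eq_add_neg]
  · intro σ _ hσ
    simp only [Finset.mem_insert, Finset.mem_singleton, not_or] at hσ
    by_contra hprod
    have hfac : ∀ i, σ i = i ∨ next ℓ (σ i) = i := by
      intro i
      by_contra hi
      push Not at hi
      apply hprod
      rw [Finset.prod_eq_zero (Finset.mem_univ i), mul_zero]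
      simp [cyclic, hi.1, hi.2]
    have hstep : ∀ i, σ i = i → σ (next ℓ i) = next ℓ i := by
      intro i hi
      refine (hfac (next ℓ i)).resolve_right fun h => ?_
      have h1 : σ (next ℓ i) = σ i := by rw [hi]; exact (next ℓ).injective h
      exact next_ne i (σ.injective h1)
    by_cases hfix : ∃ i, σ i = i
    · obtain ⟨i₀, hi₀⟩ := hfix
      exact hσ.1 (Equiv.ext fun i => forall_of_next (P := fun i => σ i = i) hstep hi₀ i)
    · push Not at hfix
      refine hσ.2 (Equiv.ext fun i => ?_)
      rw [Equiv.eq_symm_apply]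
      exact (hfac i).resolve_left (hfix i)

end Cyclic

/-- Factorisation of the matrix quadratic by a solution of the matrix equation. -/
lemma factorization {K n : Type*} [CommRing K] [Fintype n] [DecidableEq n] {R A B U : Matrix n n K}
    (h : R ^ 2 * A + R * (B - 1) + U = 0) (z : K) :
    (z • 1 - R) * (z • A + (B - 1 + R * A)) = z ^ 2 • A + z • (B - 1) + U := by
  have hU : U = -(R ^ 2 * A + R * (B - 1)) := eq_neg_of_add_eq_zero_right h
  rw [hU]
  simp only [sub_mul, mul_add, mul_sub, smul_mul_assoc, one_mul, mul_smul_comm, smul_sub,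
    mul_one, smul_smul, pow_two, mul_assoc]
  abel

/-! ### The blocks -/

/-- Weights of the transitions one level down. -/
def wDown (ℓ : ℕ) (p : ℝ) (i : Phase ℓ) : ℝ := if (i : ℕ) < ℓ then 0 else 1 - p

/-- Weights of the transitions inside a level. -/
def wStay (ℓ : ℕ) (p : ℝ) (i : Phase ℓ) : ℝ := if (i : ℕ) < ℓ then 1 - p else p

/-- Weights of the transitions one level up. -/
def wUp (ℓ : ℕ) (p : ℝ) (i : Phase ℓ) : ℝ := if (i : ℕ) < ℓ then p else 0

lemma blockDown_eq (ℓ : ℕ) (p : ℝ) : blockDown ℓ p = cyclic (wDown ℓ p) := by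
  ext i j
  simp only [blockDown, cyclic, of_apply, follows_iff, wDown]

lemma blockStay_eq (ℓ : ℕ) (p : ℝ) : blockStay ℓ p = cyclic (wStay ℓ p) := by
  ext i j
  simp only [blockStay, cyclic, of_apply, follows_iff, wStay]

lemma blockUp_eq (ℓ : ℕ) (p : ℝ) : blockUp ℓ p = cyclic (wUp ℓ p) := by
  ext i j
  simp only [blockUp, cyclic, of_apply, follows_iff, wUp]

lemma w_sum (ℓ : ℕ) (p : ℝ) (i : Phase ℓ) : wDown ℓ p i + wStay ℓ p i + wUp ℓ p i = 1 := by
  unfold wDown wStay wUp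
  split_ifs <;> ring

/-- `z² A₋₁ + z A₀ + A₁` in terms of weights. -/
def wPencil {K : Type*} [CommRing K] [Algebra ℝ K] (ℓ : ℕ) (p : ℝ) (z : K) (i : Phase ℓ) : K :=
  z ^ 2 * algebraMap ℝ K (wDown ℓ p i) + z * algebraMap ℝ K (wStay ℓ p i)
    + algebraMap ℝ K (wUp ℓ p i)

section Pencil

variable {ℓ : ℕ} {p : ℝ} {K : Type*} [CommRing K] [Algebra ℝ K]

lemma wPencil_of_lt (z : K) {i : Phase ℓ} (hi : (i : ℕ) < ℓ) :
    wPencil ℓ p z i = algebraMap ℝ K (1 - p) * z + algebraMap ℝ K p := by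
  simp only [wPencil, wDown, wStay, wUp, hi, if_true, map_zero]
  ring

lemma wPencil_of_ge (z : K) {i : Phase ℓ} (hi : ¬ (i : ℕ) < ℓ) :
    wPencil ℓ p z i = z * (algebraMap ℝ K (1 - p) * z + algebraMap ℝ K p) := by
  simp only [wPencil, wDown, wStay, wUp, hi, if_false, map_zero]
  ring

lemma prod_wPencil (z : K) :
    ∏ i, wPencil ℓ p z i
      = z ^ ℓ * ((algebraMap ℝ K (1 - p) * z + algebraMap ℝ K p) ^ 2) ^ ℓ := by
  have h : ∀ i : Phase ℓ, wPencil ℓ p z i = (fun n : ℕ => if n < ℓ then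
      algebraMap ℝ K (1 - p) * z + algebraMap ℝ K p
      else z * (algebraMap ℝ K (1 - p) * z + algebraMap ℝ K p)) i := by
    intro i
    by_cases hi : (i : ℕ) < ℓ
    · rw [wPencil_of_lt z hi]; simp only [hi, if_true]
    · rw [wPencil_of_ge z hi]; simp only [hi, if_false]
  rw [Finset.prod_congr rfl fun i _ => h i, Fin.prod_univ_eq_prod_range (fun n : ℕ => if n < ℓ then
      algebraMap ℝ K (1 - p) * z + algebraMap ℝ K p
      else z * (algebraMap ℝ K (1 - p) * z + algebraMap ℝ K p)), two_mul,
    Finset.prod_range_add, Finset.prod_congr rfl (g := fun _ =>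
      algebraMap ℝ K (1 - p) * z + algebraMap ℝ K p)
      fun i hi => if_pos (Finset.mem_range.1 hi)]
  simp only [Nat.not_lt.2 (Nat.le_add_right _ _), if_false, Finset.prod_const, Finset.card_range,
    mul_pow]
  generalize algebraMap ℝ K (1 - p) * z + algebraMap ℝ K p = y
  ring

lemma det_pencil (hℓ : 1 ≤ ℓ) (z : K) :
    (diagonal (fun _ => -z) + cyclic (wPencil ℓ p z)).det
      = -(z ^ ℓ * (((algebraMap ℝ K (1 - p) * z + algebraMap ℝ K p) ^ 2) ^ ℓ - z ^ ℓ)) := by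
  rw [det_diagonal_add_cyclic hℓ, prod_wPencil]
  simp only [Finset.prod_const, Finset.card_univ, Fintype.card_fin, pow_mul, neg_sq]
  ring

/-- The matrix quadratic `z² A₋₁ + z (A₀ - 1) + A₁` is a diagonal plus a cyclic matrix. -/
lemma pencil_eq (z : K) :
    z ^ 2 • (blockDown ℓ p).map (algebraMap ℝ K) + z • ((blockStay ℓ p).map (algebraMap ℝ K) - 1)
      + (blockUp ℓ p).map (algebraMap ℝ K)
      = diagonal (fun _ => -z) + cyclic (wPencil ℓ p z) := by
  rw [blockDown_eq, blockStay_eq, blockUp_eq, map_cyclic, map_cyclic, map_cyclic, smul_sub,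
    smul_cyclic, smul_cyclic, smul_one_eq_diagonal, ← add_sub_assoc,
    sub_add_eq_add_sub, cyclic_add, cyclic_add, sub_eq_add_neg, add_comm, diagonal_neg]
  rfl

end Pencil

/-! ### The quadratic equations -/

/-- The primitive root of unity `exp(2πi/ℓ)`. -/
def omega (ℓ : ℕ) : ℂ := Complex.exp (2 * Real.pi * Complex.I / ℓ)

lemma omega_primitive {ℓ : ℕ} (hℓ : 1 ≤ ℓ) : IsPrimitiveRoot (omega ℓ) ℓ :=
  Complex.isPrimitiveRoot_exp ℓ (by omega)

lemma norm_omega_pow {ℓ : ℕ} (hℓ : 1 ≤ ℓ) (j : ℕ) : ‖omega ℓ ^ j‖ = 1 := by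
  rw [norm_pow, (omega_primitive hℓ).norm'_eq_one (by omega), one_pow]

lemma quadratic_eq (ℓ : ℕ) (p : ℝ) (j : Fin ℓ) :
    quadratic ℓ p j = Polynomial.C ((p : ℂ) ^ 2) * Polynomial.X ^ 2
      + Polynomial.C (2 * p * (1 - p) - omega ℓ ^ (j : ℕ)) * Polynomial.X
      + Polynomial.C ((1 - p : ℂ) ^ 2) := by
  simp only [quadratic, omega, map_pow, map_sub, map_mul, Complex.ofReal_sub, Complex.ofReal_one,
    map_one, map_ofNat]
  ring

section Quadratic

variable {ℓ : ℕ} {p : ℝ}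

lemma natDegree_quadratic (hp : 0 < p) (j : Fin ℓ) : (quadratic ℓ p j).natDegree = 2 := by
  rw [quadratic_eq]
  exact Polynomial.natDegree_quadratic (by simp [hp.ne'])

lemma exists_areRoots (hp : 0 < p) : ∃ σ μ : Fin ℓ → ℂ, AreRoots ℓ p σ μ := by
  have h : ∀ j : Fin ℓ, ∃ a b : ℂ, (quadratic ℓ p j).roots = {a, b} ∧ ‖a‖ ≤ ‖b‖ := by
    intro j
    have hc : (quadratic ℓ p j).roots.card = 2 := by
      rw [← natDegree_quadratic hp j]
      exact (IsAlgClosed.splits _).natDegree_eq_card_roots.symm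
    obtain ⟨a, b, hab⟩ := Multiset.card_eq_two.1 hc
    rcases le_total ‖a‖ ‖b‖ with h | h
    · exact ⟨a, b, hab, h⟩
    · exact ⟨b, a, by rw [hab, Multiset.pair_comm], h⟩
  choose σ μ h using h
  exact ⟨σ, μ, h⟩

lemma AreRoots.vieta (hp : 0 < p) {σ μ : Fin ℓ → ℂ} (h : AreRoots ℓ p σ μ) (j : Fin ℓ) :
    (p : ℂ) ^ 2 * (σ j * μ j) = (1 - p) ^ 2 ∧
      (p : ℂ) ^ 2 * (σ j + μ j) = omega ℓ ^ (j : ℕ) - 2 * p * (1 - p) := by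
  have hlead : (quadratic ℓ p j).leadingCoeff = (p : ℂ) ^ 2 := by
    rw [quadratic_eq]
    exact Polynomial.leadingCoeff_quadratic (by simp [hp.ne'])
  have hfac := Polynomial.C_leadingCoeff_mul_prod_multiset_X_sub_C
    (p := quadratic ℓ p j) (by rw [(h j).1, natDegree_quadratic hp]; rfl)
  rw [hlead, (h j).1, quadratic_eq] at hfac
  -- The value at 0 gives the product of the roots; the value at 1 then gives their sum.
  have h0 := congrArg (Polynomial.eval 0) hfac
  have h1 := congrArg (Polynomial.eval 1) hfac
  simp at h0 h1
  constructor
  · linear_combination h0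
  · linear_combination h0 - h1

lemma AreRoots.ne_zero (hp : 0 < p) (hpq : p < 1 - p) {σ μ : Fin ℓ → ℂ}
    (h : AreRoots ℓ p σ μ) (j : Fin ℓ) : σ j ≠ 0 ∧ μ j ≠ 0 := by
  have h1 := (h.vieta hp j).1
  have hq : (1 - p : ℂ) ≠ 0 := by exact_mod_cast (hp.trans hpq).ne'
  constructor <;> intro h0 <;> rw [h0] at h1 <;>
    exact pow_ne_zero 2 hq (by simpa using h1.symm)

/-- Exchanging p and q reverses the coefficients of the quadratic, so the roots become reciprocals.
The algebra `S` allows z to be a complex number or the variable of ℂ[X]. -/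
lemma AreRoots.reversed (hp : 0 < p) (hpq : p < 1 - p) {σ μ : Fin ℓ → ℂ}
    (h : AreRoots ℓ p σ μ) (j : Fin ℓ) {S : Type*} [CommRing S] [Algebra ℂ S] (z : S) :
    (algebraMap ℂ S (1 - p) * z + algebraMap ℂ S p) ^ 2 - algebraMap ℂ S (omega ℓ ^ (j : ℕ)) * z
      = algebraMap ℂ S ((1 - p) ^ 2) * ((z - algebraMap ℂ S (1 / σ j))
        * (z - algebraMap ℂ S (1 / μ j))) := by
  obtain ⟨hσ, hμ⟩ := h.ne_zero hp hpq j
  obtain ⟨h1, h2⟩ := h.vieta hp j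
  have e1 : (1 - p : ℂ) ^ 2 * (1 / σ j * (1 / μ j)) = p ^ 2 := by
    rw [← h1]; field_simp
  have e2 : (1 - p : ℂ) ^ 2 * (1 / σ j + 1 / μ j) = omega ℓ ^ (j : ℕ) - 2 * p * (1 - p) := by
    rw [← h1, ← h2]; field_simp; ring
  have e1' := congrArg (algebraMap ℂ S) e1
  have e2' := congrArg (algebraMap ℂ S) e2
  simp only [map_mul, map_add, map_sub, map_pow, map_ofNat] at e1' e2' ⊢
  linear_combination z * e2' - e1'

lemma rho_pos (hp : 0 < p) (hpq : p < 1 - p) : 0 < rho p := div_pos hp (hp.trans hpq)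

lemma rho_lt_one (hp : 0 < p) (hpq : p < 1 - p) : rho p < 1 :=
  (div_lt_one (hp.trans hpq)).2 hpq

lemma rho_sq_lt_one (hp : 0 < p) (hpq : p < 1 - p) : rho p ^ 2 < 1 :=
  pow_lt_one₀ (rho_pos hp hpq).le (rho_lt_one hp hpq) two_ne_zero

lemma rho_mul (hp : 0 < p) (hpq : p < 1 - p) : rho p * (1 - p) = p :=
  div_mul_cancel₀ _ (hp.trans hpq).ne'

/-- A solution of `(qz+p)² = wz` with `|w| = 1` avoids the annulus `ρ² < |z| < 1`. -/
lemma norm_solution (hp : 0 < p) (hpq : p < 1 - p) {w z : ℂ} (hw : ‖w‖ = 1)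
    (hz : ((1 - p) * z + p) ^ 2 = w * z) : ‖z‖ ≤ rho p ^ 2 ∨ 1 ≤ ‖z‖ := by
  have hq := hp.trans hpq
  have h1 : ‖(1 - p) * z + (p : ℂ)‖ ^ 2 = ‖z‖ := by rw [← norm_pow, hz, norm_mul, hw, one_mul]
  have h2 : ‖(1 - p) * z + (p : ℂ)‖ ≤ (1 - p) * ‖z‖ + p := by
    refine (norm_add_le _ _).trans_eq ?_
    have : (1 - p : ℂ) = ((1 - p : ℝ) : ℂ) := by push_cast; rfl
    rw [norm_mul, this, Complex.norm_real, Complex.norm_real, Real.norm_of_nonneg hq.le,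
      Real.norm_of_nonneg hp.le]
  have h3 : ‖z‖ ≤ ((1 - p) * ‖z‖ + p) ^ 2 :=
    h1.symm.le.trans (pow_le_pow_left₀ (norm_nonneg _) h2 2)
  by_contra! hc
  have hρ := rho_mul hp hpq
  -- For r = ‖z‖, p + q = 1 gives (qr+p)² - r = q²(r - ρ²)(r - 1), which `h3` makes non-negative.
  have h4 : (1 - p) ^ 2 * ((‖z‖ - rho p ^ 2) * (1 - ‖z‖)) > 0 :=
    mul_pos (pow_pos hq 2) (mul_pos (by linarith [hc.1]) (by linarith [hc.2]))
  have h5 : (1 - p) ^ 2 * rho p ^ 2 = p ^ 2 := by rw [← mul_pow, mul_comm, hρ]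
  nlinarith

/-- Once |z| = ρ² is known, |qz+p|² = |z| is linear in Re z, and ρ² solves it; hence Re z = ρ² =
|z|. -/
lemma eq_of_norm_eq (hp : 0 < p) (hpq : p < 1 - p) {w z : ℂ} (hw : ‖w‖ = 1)
    (hz : ((1 - p) * z + p) ^ 2 = w * z) (hn : ‖z‖ = rho p ^ 2) : z = (rho p : ℂ) ^ 2 := by
  have hq := hp.trans hpq
  have hρ := rho_mul hp hpq
  have h1 : ‖(1 - p) * z + (p : ℂ)‖ ^ 2 = ‖z‖ := by rw [← norm_pow, hz, norm_mul, hw, one_mul]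
  rw [← Complex.normSq_eq_norm_sq, Complex.normSq_apply, hn] at h1
  have h2 : z.re * z.re + z.im * z.im = (rho p ^ 2) ^ 2 := by
    rw [← hn, ← Complex.normSq_eq_norm_sq, Complex.normSq_apply]
  simp at h1
  have hre : z.re = rho p ^ 2 := by
    have : 2 * p * (1 - p) * (z.re - rho p ^ 2) = 0 := by
      have hρ2 : rho p ^ 2 = ((1 - p) * rho p ^ 2 + p) ^ 2 := by
        have : (1 - p) * rho p ^ 2 + p = rho p := by linear_combination (rho p - 1) * hρ
        rw [this]
      linear_combination h1 + hρ2 - (1 - p) ^ 2 * h2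
    have h3 : 2 * p * (1 - p) ≠ 0 := by positivity
    have := (mul_eq_zero.1 this).resolve_left h3
    linarith
  have him : z.im = 0 := by
    rw [hre] at h2
    have : z.im * z.im = 0 := by linarith
    exact mul_self_eq_zero.1 this
  apply Complex.ext
  · rw [hre, ← Complex.ofReal_pow, Complex.ofReal_re]
  · rw [him, ← Complex.ofReal_pow, Complex.ofReal_im]

lemma AreRoots.inv_solution (hp : 0 < p) (hpq : p < 1 - p) {σ μ : Fin ℓ → ℂ}
    (h : AreRoots ℓ p σ μ) (j : Fin ℓ) :
    ((1 - p) * (1 / μ j) + p : ℂ) ^ 2 = omega ℓ ^ (j : ℕ) * (1 / μ j) ∧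
    ((1 - p) * (1 / σ j) + p : ℂ) ^ 2 = omega ℓ ^ (j : ℕ) * (1 / σ j) := by
  have h1 := h.reversed hp hpq j (1 / μ j)
  have h2 := h.reversed hp hpq j (1 / σ j)
  simp only [Algebra.algebraMap_self, RingHom.id_apply, sub_self, mul_zero, zero_mul] at h1 h2
  exact ⟨sub_eq_zero.1 h1, sub_eq_zero.1 h2⟩

/-- The two reciprocals have moduli with product ρ² < 1 and avoid the annulus of `norm_solution`.
They cannot both be at least 1, nor both at most ρ², as ρ⁴ < ρ². -/
lemma AreRoots.norm_le (hℓ : 1 ≤ ℓ) (hp : 0 < p) (hpq : p < 1 - p) {σ μ : Fin ℓ → ℂ}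
    (h : AreRoots ℓ p σ μ) (j : Fin ℓ) : ‖1 / μ j‖ ≤ rho p ^ 2 ∧ 1 ≤ ‖1 / σ j‖ := by
  obtain ⟨hμ, hσ⟩ := h.inv_solution hp hpq j
  have hw := norm_omega_pow hℓ j
  have hne := h.ne_zero hp hpq j
  have hρ0 := rho_pos hp hpq
  have hρ1 := rho_lt_one hp hpq
  have hprod : ‖1 / σ j‖ * ‖1 / μ j‖ = rho p ^ 2 := by
    have h1 := congrArg norm (h.vieta hp j).1
    have : (1 - p : ℂ) = ((1 - p : ℝ) : ℂ) := by push_cast; rfl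
    have hq := hp.trans hpq
    rw [norm_mul, norm_mul, norm_pow, this, norm_pow, Complex.norm_real, Complex.norm_real,
      Real.norm_of_nonneg hq.le, Real.norm_of_nonneg hp.le] at h1
    have h2 : ‖σ j‖ ≠ 0 := norm_ne_zero_iff.2 hne.1
    have h3 : ‖μ j‖ ≠ 0 := norm_ne_zero_iff.2 hne.2
    rw [norm_div, norm_div, norm_one, rho]
    field_simp
    linear_combination -h1
  have hle : ‖1 / μ j‖ ≤ ‖1 / σ j‖ := by
    rw [norm_div, norm_div, norm_one]
    exact one_div_le_one_div_of_le (norm_pos_iff.2 hne.1) (h j).2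
  have hsmall : ‖1 / μ j‖ ≤ rho p ^ 2 := by
    refine (norm_solution hp hpq hw hμ).resolve_right fun h1 => ?_
    nlinarith
  refine ⟨hsmall, (norm_solution hp hpq hw hσ).resolve_left fun h1 => ?_⟩
  have : rho p ^ 2 < 1 := rho_sq_lt_one hp hpq
  have : 0 < rho p ^ 2 := by positivity
  nlinarith [norm_nonneg (1 / μ j)]

/-- The equation recovers ω^j from z = 1/μⱼ as (qz+p)²/z. -/
lemma AreRoots.inv_injective (hℓ : 1 ≤ ℓ) (hp : 0 < p) (hpq : p < 1 - p) {σ μ : Fin ℓ → ℂ}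
    (h : AreRoots ℓ p σ μ) : Function.Injective (fun j => 1 / μ j) := by
  intro i j hij
  simp only at hij
  have h1 := (h.inv_solution hp hpq i).1
  have h2 := (h.inv_solution hp hpq j).1
  rw [hij, h2] at h1
  have h3 := mul_right_cancel₀ (one_div_ne_zero (h.ne_zero hp hpq j).2) h1
  exact Fin.ext ((omega_primitive hℓ).pow_inj i.2 j.2 h3.symm)

/-- `ρ⁻²` is one of the `μ j`. -/
lemma AreRoots.exists_eq_rho_sq (hℓ : 1 ≤ ℓ) (hp : 0 < p) (hpq : p < 1 - p) {σ μ : Fin ℓ → ℂ}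
    (h : AreRoots ℓ p σ μ) : ∃ j, 1 / μ j = (rho p : ℂ) ^ 2 := by
  -- For j = 0 the identity qρ² + p = ρ shows that ρ² is a solution; having modulus below 1, it is
  -- not 1/σ₀.
  refine ⟨⟨0, hℓ⟩, ?_⟩
  have h1 := h.reversed hp hpq ⟨0, hℓ⟩ ((rho p : ℂ) ^ 2)
  have hρ : (rho p : ℂ) * (1 - p) = p := by exact_mod_cast rho_mul hp hpq
  have hz : (1 - p) * (rho p : ℂ) ^ 2 + p = rho p := by linear_combination (rho p - 1 : ℂ) * hρ
  simp only [Algebra.algebraMap_self, RingHom.id_apply, hz, pow_zero, one_mul, sub_self] at h1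
  have hq : (1 - p : ℂ) ≠ 0 := by exact_mod_cast (hp.trans hpq).ne'
  have h2 := (mul_eq_zero.1 h1.symm).resolve_left (pow_ne_zero 2 hq)
  rcases mul_eq_zero.1 h2 with h3 | h3
  · exfalso
    have h4 := (h.norm_le hℓ hp hpq ⟨0, hℓ⟩).2
    rw [← sub_eq_zero.1 h3, norm_pow, Complex.norm_real, Real.norm_of_nonneg (rho_pos hp hpq).le]
      at h4
    exact absurd (rho_sq_lt_one hp hpq) (not_lt.2 h4)
  · exact (sub_eq_zero.1 h3).symm

end Quadratic

/-! ### The characteristic polynomial of a rate matrix -/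

section Charpoly

variable {ℓ : ℕ} {p : ℝ}

/-- With x = (qz+p)² this splits the determinant of the pencil into the ℓ reversed quadratics. -/
lemma prod_quadratic (hℓ : 1 ≤ ℓ) {S : Type*} [CommRing S] [IsDomain S] [Algebra ℂ S]
    [FaithfulSMul ℂ S] (x z : S) :
    x ^ ℓ - z ^ ℓ = ∏ j : Fin ℓ, (x - algebraMap ℂ S (omega ℓ ^ (j : ℕ)) * z) := by
  have hζ : IsPrimitiveRoot (algebraMap ℂ S (omega ℓ)) ℓ :=
    (omega_primitive hℓ).map_of_injective (FaithfulSMul.algebraMap_injective ℂ S)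
  rw [hζ.pow_sub_pow_eq_prod_sub_mul x z (by omega)]
  symm
  refine Finset.prod_nbij (fun j => algebraMap ℂ S (omega ℓ) ^ (j : ℕ)) ?_ ?_ ?_ ?_
  · intro j _
    rw [Polynomial.mem_nthRootsFinset (by omega), ← pow_mul, mul_comm, pow_mul, hζ.pow_eq_one,
      one_pow]
  · intro i _ j _ hij
    exact Fin.ext (hζ.pow_inj i.2 j.2 hij)
  · intro y hy
    rw [Finset.mem_coe, Polynomial.mem_nthRootsFinset (by omega)] at hy
    have : NeZero ℓ := ⟨by omega⟩
    obtain ⟨i, hi, rfl⟩ := hζ.eq_pow_of_pow_eq_one hy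
    exact ⟨⟨i, hi⟩, Finset.mem_coe.2 (Finset.mem_univ _), rfl⟩
  · intro j _
    rw [map_pow]

/-- The second factor of the matrix quadratic. -/
def cofactor (ℓ : ℕ) (p : ℝ) (R : Matrix (Phase ℓ) (Phase ℓ) ℝ) : Matrix (Phase ℓ) (Phase ℓ) ℝ :=
  blockStay ℓ p - 1 + R * blockDown ℓ p

variable {R : Matrix (Phase ℓ) (Phase ℓ) ℝ}

lemma factorization_map
    (h : R ^ 2 * blockDown ℓ p + R * (blockStay ℓ p - 1) + blockUp ℓ p = 0)
    {K : Type*} [CommRing K] [Algebra ℝ K] (z : K) :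
    (z • 1 - R.map (algebraMap ℝ K)) * (z • (blockDown ℓ p).map (algebraMap ℝ K)
      + (cofactor ℓ p R).map (algebraMap ℝ K))
      = diagonal (fun _ => -z) + cyclic (wPencil ℓ p z) := by
  have h1 := congrArg (algebraMap ℝ K).mapMatrix h
  simp only [map_add, map_mul, map_pow, map_sub, map_one, map_zero] at h1
  have h2 := factorization h1 z
  have h3 : (cofactor ℓ p R).map (algebraMap ℝ K)
      = (algebraMap ℝ K).mapMatrix (blockStay ℓ p) - 1
        + (algebraMap ℝ K).mapMatrix R * (algebraMap ℝ K).mapMatrix (blockDown ℓ p) := by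
    rw [← RingHom.mapMatrix_apply, cofactor, map_add, map_sub, map_one, map_mul]
  rw [h3, ← pencil_eq]
  exact h2

lemma det_factorization (hℓ : 1 ≤ ℓ)
    (h : R ^ 2 * blockDown ℓ p + R * (blockStay ℓ p - 1) + blockUp ℓ p = 0)
    {K : Type*} [CommRing K] [Algebra ℝ K] (z : K) :
    (z • 1 - R.map (algebraMap ℝ K)).det * (z • (blockDown ℓ p).map (algebraMap ℝ K)
      + (cofactor ℓ p R).map (algebraMap ℝ K)).det
      = -(z ^ ℓ * (((algebraMap ℝ K (1 - p) * z + algebraMap ℝ K p) ^ 2) ^ ℓ - z ^ ℓ)) := by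
  rw [← det_mul, factorization_map h, det_pencil hℓ]

/-- The multiset of all the roots of the determinant of the matrix quadratic. -/
def pencilRoots (σ μ : Fin ℓ → ℂ) : Multiset ℂ :=
  Multiset.replicate ℓ 0 + Finset.univ.val.map (fun j => 1 / μ j)
    + Finset.univ.val.map (fun j => 1 / σ j)

/-- Taking z to be the variable of ℂ[X], rather than a number, keeps track of multiplicities. -/
lemma charpoly_mul (hℓ : 1 ≤ ℓ) (hp : 0 < p) (hpq : p < 1 - p)
    (h : R ^ 2 * blockDown ℓ p + R * (blockStay ℓ p - 1) + blockUp ℓ p = 0)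
    {σ μ : Fin ℓ → ℂ} (hr : AreRoots ℓ p σ μ) :
    (toComplex R).charpoly * ((Polynomial.X : ℂ[X]) • (blockDown ℓ p).map (algebraMap ℝ ℂ[X])
      + (cofactor ℓ p R).map (algebraMap ℝ ℂ[X])).det
      = Polynomial.C (-(((1 - p : ℂ) ^ 2) ^ ℓ))
        * ((pencilRoots σ μ).map fun a => Polynomial.X - Polynomial.C a).prod := by
  have h1 : (toComplex R).charmatrix = (Polynomial.X : ℂ[X]) • 1 - R.map (algebraMap ℝ ℂ[X]) := by
    rw [charmatrix, scalar_apply, smul_one_eq_diagonal]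
    rfl
  have ha : ∀ r : ℝ, algebraMap ℝ ℂ[X] r = algebraMap ℂ ℂ[X] (r : ℂ) := fun r => rfl
  rw [Matrix.charpoly, h1, det_factorization hℓ h, ha, ha, prod_quadratic hℓ]
  have h2 : ∀ j : Fin ℓ, (algebraMap ℂ ℂ[X] ((1 - p : ℝ) : ℂ) * Polynomial.X
        + algebraMap ℂ ℂ[X] p) ^ 2 - algebraMap ℂ ℂ[X] (omega ℓ ^ (j : ℕ)) * Polynomial.X
      = Polynomial.C ((1 - p : ℂ) ^ 2) * ((Polynomial.X - Polynomial.C (1 / σ j))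
        * (Polynomial.X - Polynomial.C (1 / μ j))) := by
    intro j
    have := hr.reversed hp hpq j (Polynomial.X : ℂ[X])
    rw [Complex.ofReal_sub, Complex.ofReal_one]
    exact this
  rw [Finset.prod_congr rfl fun j _ => h2 j, Finset.prod_mul_distrib, Finset.prod_mul_distrib,
    Finset.prod_const, Finset.card_univ, Fintype.card_fin]
  simp only [pencilRoots, Multiset.map_add, Multiset.prod_add, Multiset.map_replicate,
    Multiset.prod_replicate, Multiset.map_map, Polynomial.C_neg, Polynomial.C_pow, Polynomial.C_0, sub_zero, Finset.prod,
    Function.comp_def]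
  ring

lemma roots_add (hℓ : 1 ≤ ℓ) (hp : 0 < p) (hpq : p < 1 - p)
    (h : R ^ 2 * blockDown ℓ p + R * (blockStay ℓ p - 1) + blockUp ℓ p = 0)
    {σ μ : Fin ℓ → ℂ} (hr : AreRoots ℓ p σ μ) :
    (toComplex R).charpoly.roots
      + ((Polynomial.X : ℂ[X]) • (blockDown ℓ p).map (algebraMap ℝ ℂ[X])
      + (cofactor ℓ p R).map (algebraMap ℝ ℂ[X])).det.roots = pencilRoots σ μ ∧
    ((Polynomial.X : ℂ[X]) • (blockDown ℓ p).map (algebraMap ℝ ℂ[X])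
      + (cofactor ℓ p R).map (algebraMap ℝ ℂ[X])).det ≠ 0 := by
  have h1 := charpoly_mul hℓ hp hpq h hr
  have hq : (1 - p : ℂ) ≠ 0 := by exact_mod_cast (hp.trans hpq).ne'
  have hc : (-(((1 - p : ℂ) ^ 2) ^ ℓ)) ≠ 0 := by simp [hq]
  have hne : Polynomial.C (-(((1 - p : ℂ) ^ 2) ^ ℓ))
        * ((pencilRoots σ μ).map fun a => Polynomial.X - Polynomial.C a).prod ≠ 0 :=
    mul_ne_zero (Polynomial.C_ne_zero.2 hc)
      (Polynomial.monic_multiset_prod_of_monic _ _ fun a _ => Polynomial.monic_X_sub_C a).ne_zero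
  constructor
  · rw [← Polynomial.roots_mul (h1 ▸ hne), h1, Polynomial.roots_C_mul _ hc,
      Polynomial.roots_multiset_prod_X_sub_C]
  · exact right_ne_zero_of_mul (h1 ▸ hne)

/-- The roots form a submultiset of the part of `pencilRoots` in the open unit disk. That part has
2ℓ elements, which is the degree, so nothing is left out. -/
lemma charpoly_roots (hℓ : 1 ≤ ℓ) (hp : 0 < p) (hpq : p < 1 - p) (hR : IsRateMatrix ℓ p R)
    {σ μ : Fin ℓ → ℂ} (hr : AreRoots ℓ p σ μ) :
    (toComplex R).charpoly.roots
      = Multiset.replicate ℓ 0 + Finset.univ.val.map (fun j => 1 / μ j) := by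
  classical
  have h1 := (roots_add hℓ hp hpq hR.equation hr).1
  have hle : (toComplex R).charpoly.roots ≤ pencilRoots σ μ := h1 ▸ Multiset.le_add_right _ _
  have hlt : ∀ z ∈ (toComplex R).charpoly.roots, ‖z‖ < 1 := fun z hz =>
    hR.eigenvalues z (mem_spectrum_iff_isRoot_charpoly.2 (Polynomial.isRoot_of_mem_roots hz))
  have hle2 : (toComplex R).charpoly.roots ≤ (pencilRoots σ μ).filter (fun z => ‖z‖ < 1) := by
    rw [← Multiset.filter_eq_self.2 hlt]
    exact Multiset.filter_le_filter _ hle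
  have hfil : (pencilRoots σ μ).filter (fun z => ‖z‖ < 1)
      = Multiset.replicate ℓ 0 + Finset.univ.val.map (fun j => 1 / μ j) := by
    rw [pencilRoots, Multiset.filter_add, Multiset.filter_eq_self.2, Multiset.filter_eq_nil.2,
      add_zero]
    · intro a ha
      obtain ⟨j, _, rfl⟩ := Multiset.mem_map.1 ha
      exact not_lt.2 (hr.norm_le hℓ hp hpq j).2
    · intro a ha
      rcases Multiset.mem_add.1 ha with ha | ha
      · rw [Multiset.eq_of_mem_replicate ha, norm_zero]; exact one_pos
      · obtain ⟨j, _, rfl⟩ := Multiset.mem_map.1 ha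
        exact (hr.norm_le hℓ hp hpq j).1.trans_lt (rho_sq_lt_one hp hpq)
  rw [hfil] at hle2
  refine Multiset.eq_of_le_of_card_le hle2 ?_
  rw [← (IsAlgClosed.splits (toComplex R).charpoly).natDegree_eq_card_roots,
    charpoly_natDegree_eq_dim]
  simp [two_mul]

/-- The second factor of the pencil keeps the roots 1/σⱼ, none of which is 0; its value at z = 0 is
`cofactor`. -/
lemma det_cofactor_ne_zero (hℓ : 1 ≤ ℓ) (hp : 0 < p) (hpq : p < 1 - p) (hR : IsRateMatrix ℓ p R) :
    (cofactor ℓ p R).det ≠ 0 := by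
  obtain ⟨σ, μ, hr⟩ := exists_areRoots (ℓ := ℓ) hp
  obtain ⟨h1, h2⟩ := roots_add hℓ hp hpq hR.equation hr
  rw [charpoly_roots hℓ hp hpq hR hr, pencilRoots] at h1
  have h3 := add_left_cancel h1
  intro h0
  have h4 : Polynomial.eval 0 ((Polynomial.X : ℂ[X]) • (blockDown ℓ p).map (algebraMap ℝ ℂ[X])
      + (cofactor ℓ p R).map (algebraMap ℝ ℂ[X])).det = 0 := by
    rw [← Polynomial.coe_evalRingHom, RingHom.map_det]
    have : (Polynomial.evalRingHom (0 : ℂ)).mapMatrix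
        ((Polynomial.X : ℂ[X]) • (blockDown ℓ p).map (algebraMap ℝ ℂ[X])
        + (cofactor ℓ p R).map (algebraMap ℝ ℂ[X])) = (algebraMap ℝ ℂ).mapMatrix (cofactor ℓ p R) := by
      ext i j
      simp [Polynomial.algebraMap_apply]
    rw [this, ← RingHom.map_det, h0, map_zero]
  have h5 := (Polynomial.mem_roots h2).2 h4
  rw [h3] at h5
  obtain ⟨j, _, hj⟩ := Multiset.mem_map.1 h5
  have := (hr.norm_le hℓ hp hpq j).2
  rw [hj, norm_zero] at this
  exact absurd this (by norm_num)

end Charpoly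

/-! ### Left null vectors of the matrix quadratic -/

section Kernel

variable {ℓ : ℕ} {p : ℝ} {K : Type*} [Field K] [Algebra ℝ K]

lemma vecMul_pencil_eq_zero {K : Type*} [CommRing K] {x c : Phase ℓ → K} {z : K} :
    x ᵥ* (diagonal (fun _ => -z) + cyclic c) = 0 ↔ ∀ i, x i * c i = z * x (next ℓ i) := by
  rw [funext_iff, ← (next ℓ).forall_congr_right]
  refine forall_congr' fun i => ?_
  rw [vecMul_add, Pi.add_apply, vecMul_cyclic, vecMul_diagonal, Pi.zero_apply]
  constructor <;> intro h <;> linear_combination h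

lemma kernel_unique {K : Type*} [Field K] {x y c : Phase ℓ → K} {z : K} (hz : z ≠ 0)
    (hx : ∀ i, x i * c i = z * x (next ℓ i)) (hy : ∀ i, y i * c i = z * y (next ℓ i))
    {i₀ : Phase ℓ} (h₀ : x i₀ = y i₀) : x = y :=
  funext fun i => forall_of_next (P := fun i => x i = y i)
    (fun i hi => mul_left_cancel₀ hz (by rw [← hx, ← hy, hi])) h₀ i

/-- Each red step multiplies by (qz+p)/z. The red half of a null vector is thus a Vandermonde row,
which gives independence for distinct z. -/
lemma kernel_pow (hℓ : 1 ≤ ℓ) {x : Phase ℓ → K} {z : K} (hz : z ≠ 0)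
    (hx : ∀ i, x i * wPencil ℓ p z i = z * x (next ℓ i)) (n : ℕ) (hn : n < ℓ) :
    x ⟨n, by omega⟩ = x ⟨0, by omega⟩
      * (algebraMap ℝ K (1 - p) + algebraMap ℝ K p * z⁻¹) ^ n := by
  induction n with
  | zero => simp
  | succ n ih =>
    have h1 := hx ⟨n, by omega⟩
    rw [wPencil_of_lt z (show n < ℓ by omega), next_of_lt (by omega), ih (by omega)] at h1
    rw [← mul_right_inj' hz, ← h1, pow_succ]
    field_simp

lemma exists_kernel_vec (hℓ : 1 ≤ ℓ) {z : K} (hz : z ≠ 0)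
    (h : ((algebraMap ℝ K (1 - p) * z + algebraMap ℝ K p) ^ 2) ^ ℓ = z ^ ℓ) :
    ∃ x : Phase ℓ → K, x ⟨0, by omega⟩ = 1 ∧ ∀ i, x i * wPencil ℓ p z i = z * x (next ℓ i) := by
  have hdet := det_pencil (p := p) hℓ z
  rw [h, sub_self, mul_zero, neg_zero] at hdet
  obtain ⟨y, hy0, hy⟩ := exists_vecMul_eq_zero_iff.2 hdet
  rw [vecMul_pencil_eq_zero] at hy
  have hne : y ⟨0, by omega⟩ ≠ 0 := fun h0 =>
    hy0 (kernel_unique hz hy (y := 0) (fun i => by simp) h0)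
  refine ⟨fun i => (y ⟨0, by omega⟩)⁻¹ * y i, inv_mul_cancel₀ hne, fun i => ?_⟩
  rw [mul_assoc, hy i]
  ring

lemma rho_eq (hp : 0 < p) (hpq : p < 1 - p) : (1 - p) * rho p ^ 2 + p = rho p := by
  linear_combination (rho p - 1) * rho_mul hp hpq

/-- At z = ρ² one has qz + p = ρ, so a red step divides by ρ and a green step multiplies by ρ; this
dictates the shape of û. -/
lemma uHat_kernel (hp : 0 < p) (hpq : p < 1 - p) (i : Phase ℓ) :
    uHat ℓ p i * wPencil ℓ p (rho p ^ 2) i = rho p ^ 2 * uHat ℓ p (next ℓ i) := by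
  have hi := i.2
  have hρ := rho_eq hp hpq
  have hnext := coe_next i
  by_cases h : (i : ℕ) < ℓ
  · rw [wPencil_of_lt _ h]
    rw [Nat.mod_eq_of_lt (by omega)] at hnext
    simp only [Algebra.algebraMap_self, RingHom.id_apply, hρ, uHat, h, if_true, hnext]
    obtain ⟨m, hm⟩ : ∃ m, ℓ - (i : ℕ) = m + 1 := ⟨ℓ - i - 1, by omega⟩
    rw [hm]
    split_ifs with h2
    · rw [show ℓ - ((i : ℕ) + 1) = m by omega]; ring
    · rw [show (i : ℕ) + 1 - ℓ = 0 by omega, show m = 0 by omega]; ring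
  · rw [wPencil_of_ge _ h]
    simp only [Algebra.algebraMap_self, RingHom.id_apply, hρ, uHat, h, if_false, hnext]
    rcases Nat.lt_or_ge ((i : ℕ) + 1) (2 * ℓ) with h2 | h2
    · rw [Nat.mod_eq_of_lt h2, if_neg (by omega), show (i : ℕ) + 1 - ℓ = (i : ℕ) - ℓ + 1 by omega]
      ring
    · rw [show (i : ℕ) + 1 = 2 * ℓ by omega, Nat.mod_self, if_pos (by omega),
        show ℓ - 0 = (i : ℕ) - ℓ + 1 by omega]
      ring

lemma uHat_pos (hp : 0 < p) (hpq : p < 1 - p) (i : Phase ℓ) : 0 < uHat ℓ p i := by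
  unfold uHat
  have := rho_pos hp hpq
  split_ifs <;> positivity

lemma uHat_kernel_complex (hp : 0 < p) (hpq : p < 1 - p) (i : Phase ℓ) :
    (uHat ℓ p i : ℂ) * wPencil ℓ p ((rho p : ℂ) ^ 2) i
      = (rho p : ℂ) ^ 2 * (uHat ℓ p (next ℓ i) : ℂ) := by
  have h := congrArg (algebraMap ℝ ℂ) (uHat_kernel hp hpq i)
  simp only [wPencil, map_mul, map_add, map_pow, Algebra.algebraMap_self, RingHom.id_apply] at h
  exact h

end Kernel

/-! ### Diagonalisation of the rate matrix -/

section Diagonalisation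

variable {ℓ : ℕ} {p : ℝ} {R : Matrix (Phase ℓ) (Phase ℓ) ℝ}

lemma mul_cofactor (h : R ^ 2 * blockDown ℓ p + R * (blockStay ℓ p - 1) + blockUp ℓ p = 0) :
    R * cofactor ℓ p R = -blockUp ℓ p := by
  rw [cofactor, mul_add, ← mul_assoc, ← pow_two, add_comm]
  exact eq_neg_of_add_eq_zero_left h

/-- The queue cannot grow during green, so the corresponding rows of R · `cofactor` = -A₁ vanish,
and `cofactor` is nonsingular. -/
lemma row_eq_zero (hℓ : 1 ≤ ℓ) (hp : 0 < p) (hpq : p < 1 - p) (hR : IsRateMatrix ℓ p R)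
    {i : Phase ℓ} (hi : ¬ (i : ℕ) < ℓ) : R i = 0 := by
  have h1 := mul_cofactor hR.equation
  refine eq_zero_of_vecMul_eq_zero (det_cofactor_ne_zero hℓ hp hpq hR) (funext fun j => ?_)
  have h2 := congrFun (congrFun h1 i) j
  rw [mul_apply_eq_vecMul, Matrix.neg_apply, blockUp_eq] at h2
  rw [h2]
  simp [cyclic, wUp, hi]

lemma left_eigenvector_kernel (hR : IsRateMatrix ℓ p R) {x : Phase ℓ → ℂ} {z : ℂ}
    (hx : x ᵥ* toComplex R = z • x) (i : Phase ℓ) :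
    x i * wPencil ℓ p z i = z * x (next ℓ i) := by
  revert i
  rw [← vecMul_pencil_eq_zero, ← factorization_map hR.equation, ← vecMul_vecMul, vecMul_sub, hx,
    vecMul_smul, vecMul_one, sub_self, zero_vecMul]

/-- A solution of the scalar equations that is an eigenvalue has all the null vectors of the matrix
quadratic as left eigenvectors. -/
lemma left_eigenvector_of_kernel (hR : IsRateMatrix ℓ p R) {z : ℂ} (hz : z ≠ 0)
    (hroot : z ∈ (toComplex R).charpoly.roots) {x : Phase ℓ → ℂ} (i₀ : Phase ℓ)
    (hx : ∀ i, x i * wPencil ℓ p z i = z * x (next ℓ i)) : x ᵥ* toComplex R = z • x := by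
  have hdet : (z • 1 - toComplex R).det = 0 := by
    have := Polynomial.isRoot_of_mem_roots hroot
    rw [Polynomial.IsRoot, eval_charpoly, scalar_apply] at this
    rwa [smul_one_eq_diagonal]
  -- Any eigenvector y is itself a null vector of the pencil, and that null space is a line, so x is
  -- a multiple of y.
  obtain ⟨y, hy0, hy⟩ := exists_vecMul_eq_zero_iff.2 hdet
  rw [vecMul_sub, vecMul_smul, vecMul_one, sub_eq_zero, eq_comm] at hy
  have hyk := left_eigenvector_kernel hR hy
  have hyi : y i₀ ≠ 0 := fun h0 => hy0 (kernel_unique hz hyk (y := 0) (fun i => by simp) h0)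
  have hxy : x = (x i₀ * (y i₀)⁻¹) • y := by
    refine kernel_unique hz hx (fun i => ?_) (i₀ := i₀) ?_
    · rw [Pi.smul_apply, Pi.smul_apply, smul_eq_mul, smul_eq_mul, mul_assoc, hyk i]
      ring
    · rw [Pi.smul_apply, smul_eq_mul, mul_assoc, inv_mul_cancel₀ hyi, mul_one]
  rw [hxy, smul_vecMul, hy, smul_comm]

/-- `ρ²` is a simple and strictly dominant eigenvalue. -/
lemma spectrum_rateMatrix (hℓ : 1 ≤ ℓ) (hp : 0 < p) (hpq : p < 1 - p) (hR : IsRateMatrix ℓ p R) :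
    (rho p : ℂ) ^ 2 ∈ spectrum ℂ (toComplex R) ∧
      (toComplex R).charpoly.rootMultiplicity ((rho p : ℂ) ^ 2) = 1 ∧
      ∀ z ∈ spectrum ℂ (toComplex R), z ≠ (rho p : ℂ) ^ 2 → ‖z‖ < rho p ^ 2 := by
  classical
  obtain ⟨σ, μ, hr⟩ := exists_areRoots (ℓ := ℓ) hp
  have hroots := charpoly_roots hℓ hp hpq hR hr
  obtain ⟨j₀, hj₀⟩ := hr.exists_eq_rho_sq hℓ hp hpq
  have hmult : (toComplex R).charpoly.rootMultiplicity ((rho p : ℂ) ^ 2) = 1 := by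
    have hne : (rho p : ℂ) ^ 2 ≠ 0 := pow_ne_zero 2 (by exact_mod_cast (rho_pos hp hpq).ne')
    rw [← Polynomial.count_roots, hroots, Multiset.count_add, Multiset.count_eq_zero.2, zero_add,
      ← hj₀]
    · exact Multiset.count_eq_one_of_mem
        ((Multiset.nodup_map_iff_of_injective (hr.inv_injective hℓ hp hpq)).2 Finset.univ.nodup)
        (Multiset.mem_map.2 ⟨j₀, Finset.mem_univ_val _, rfl⟩)
    · exact fun h => hne (Multiset.eq_of_mem_replicate h)
  have hpoly : (toComplex R).charpoly ≠ 0 := (charpoly_monic _).ne_zero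
  refine ⟨?_, hmult, fun z hz hne => ?_⟩
  · rw [mem_spectrum_iff_isRoot_charpoly, ← Polynomial.rootMultiplicity_pos hpoly, hmult]
    exact one_pos
  · rw [mem_spectrum_iff_isRoot_charpoly, ← Polynomial.mem_roots hpoly, hroots] at hz
    rcases Multiset.mem_add.1 hz with h | h
    · rw [Multiset.eq_of_mem_replicate h, norm_zero]
      exact pow_pos (rho_pos hp hpq) 2
    · obtain ⟨j, _, rfl⟩ := Multiset.mem_map.1 h
      exact lt_of_le_of_ne (hr.norm_le hℓ hp hpq j).1 fun hn =>
        hne (eq_of_norm_eq hp hpq (norm_omega_pow hℓ j) (hr.inv_solution hp hpq j).1 hn)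

/-- The rate matrices are diagonalised by one and the same basis of left eigenvectors. -/
lemma exists_diagonalisation (hℓ : 1 ≤ ℓ) (hp : 0 < p) (hpq : p < 1 - p) :
    ∃ (B : Matrix (Phase ℓ) (Phase ℓ) ℂ) (d : Phase ℓ → ℂ), IsUnit B ∧
      (∀ i, d i ≠ (rho p : ℂ) ^ 2 → ‖d i‖ < rho p ^ 2) ∧
      (∃ i, d i = (rho p : ℂ) ^ 2) ∧
      (∀ i, d i = (rho p : ℂ) ^ 2 → ∃ c : ℂ, c ≠ 0 ∧ B i = c • fun k => (uHat ℓ p k : ℂ)) ∧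
      ∀ R, IsRateMatrix ℓ p R → B * toComplex R = diagonal d * B := by
  obtain ⟨σ, μ, hr⟩ := exists_areRoots (ℓ := ℓ) hp
  have hz : ∀ j, 1 / μ j ≠ 0 := fun j => one_div_ne_zero (hr.ne_zero hp hpq j).2
  have hsol : ∀ j, ((algebraMap ℝ ℂ (1 - p) * (1 / μ j) + algebraMap ℝ ℂ p) ^ 2) ^ ℓ
      = (1 / μ j) ^ ℓ := by
    intro j
    have h1 := (hr.inv_solution hp hpq j).1
    simp only [Complex.coe_algebraMap, Complex.ofReal_sub, Complex.ofReal_one]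
    rw [h1, mul_pow, ← pow_mul, mul_comm (j : ℕ), pow_mul, (omega_primitive hℓ).pow_eq_one, one_pow,
      one_mul]
  choose x hx0 hx using fun j => exists_kernel_vec hℓ (hz j) (hsol j)
  have hρ0 : (rho p : ℂ) ≠ 0 := by exact_mod_cast (rho_pos hp hpq).ne'
  -- Red indices carry 1/μᵢ and its null vector; green indices carry 0 and a coordinate vector,
  -- since the green rows of R vanish.
  let d : Phase ℓ → ℂ := fun i => if h : (i : ℕ) < ℓ then 1 / μ ⟨i, h⟩ else 0
  let B : Matrix (Phase ℓ) (Phase ℓ) ℂ :=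
    fun i => if h : (i : ℕ) < ℓ then x ⟨i, h⟩ else Pi.single i 1
  have hd : ∀ (i : Phase ℓ) (h : (i : ℕ) < ℓ), d i = 1 / μ ⟨i, h⟩ := fun i h => dif_pos h
  have hd' : ∀ i : Phase ℓ, ¬ (i : ℕ) < ℓ → d i = 0 := fun i h => dif_neg h
  have hB : ∀ (i : Phase ℓ) (h : (i : ℕ) < ℓ), B i = x ⟨i, h⟩ := fun i h => dif_pos h
  have hB' : ∀ i : Phase ℓ, ¬ (i : ℕ) < ℓ → B i = Pi.single i 1 := fun i h => dif_neg h
  refine ⟨B, d, ?_, ?_, ?_, ?_, ?_⟩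
  -- The coordinate rows kill the green entries of w; a Vandermonde system kills the red ones.
  · rw [← mulVec_injective_iff_isUnit]
    refine (injective_iff_map_eq_zero (mulVecLin B)).2 fun w hw => ?_
    rw [mulVecLin_apply] at hw
    have hrow : ∀ i, B i ⬝ᵥ w = 0 := fun i => congrFun hw i
    have hw' : ∀ i : Phase ℓ, ¬ (i : ℕ) < ℓ → w i = 0 := by
      intro i hi
      simpa [hB' i hi] using hrow i
    have hinj : Function.Injective
        (fun j : Fin ℓ => algebraMap ℝ ℂ (1 - p) + algebraMap ℝ ℂ p * (1 / μ j)⁻¹) := by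
      intro j k hjk
      apply hr.inv_injective hℓ hp hpq
      have hp' : algebraMap ℝ ℂ p ≠ 0 := by simpa using hp.ne'
      exact inv_injective (mul_left_cancel₀ hp' (add_left_cancel hjk))
    have hlow : (fun k : Fin ℓ => w ⟨k, by omega⟩) = 0 := by
      refine eq_zero_of_forall_index_sum_pow_mul_eq_zero hinj fun j => ?_
      have h1 := hrow ⟨j, by omega⟩
      rw [hB ⟨j, by omega⟩ j.2] at h1
      rw [← h1, dotProduct]
      refine Finset.sum_of_injOn (fun k : Fin ℓ => (⟨k, by omega⟩ : Phase ℓ)) ?_ ?_ ?_ ?_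
      · intro a _ b _ hab
        exact Fin.ext (Fin.mk.inj hab)
      · intro a _
        exact Finset.mem_coe.2 (Finset.mem_univ _)
      · intro i _ hi
        rw [hw' i fun h => hi ⟨⟨i, h⟩, Finset.mem_coe.2 (Finset.mem_univ _), rfl⟩, mul_zero]
      · intro k _
        simp only [Fin.eta]
        rw [kernel_pow hℓ (hz j) (hx j) k k.2, hx0, one_mul]
    ext i
    by_cases hi : (i : ℕ) < ℓ
    · exact congrFun hlow ⟨i, hi⟩
    · exact hw' i hi
  · intro i hi
    by_cases h : (i : ℕ) < ℓ
    · rw [hd i h] at hi ⊢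
      exact lt_of_le_of_ne (hr.norm_le hℓ hp hpq _).1 fun hn =>
        hi (eq_of_norm_eq hp hpq (norm_omega_pow hℓ _) (hr.inv_solution hp hpq _).1 hn)
    · rw [hd' i h, norm_zero]
      exact pow_pos (rho_pos hp hpq) 2
  · obtain ⟨j, hj⟩ := hr.exists_eq_rho_sq hℓ hp hpq
    exact ⟨⟨j, by omega⟩, by rw [hd _ j.2, ← hj]⟩
  · intro i hi
    by_cases h : (i : ℕ) < ℓ
    · have hu0 : (uHat ℓ p ⟨0, by omega⟩ : ℂ) ≠ 0 := by exact_mod_cast (uHat_pos hp hpq _).ne'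
      refine ⟨(uHat ℓ p ⟨0, by omega⟩ : ℂ)⁻¹, inv_ne_zero hu0, ?_⟩
      have h1 := hx ⟨i, h⟩
      rw [← hd i h, hi] at h1
      rw [hB i h]
      refine kernel_unique (pow_ne_zero 2 hρ0) h1 (fun k => ?_) (i₀ := ⟨0, by omega⟩) ?_
      · rw [Pi.smul_apply, Pi.smul_apply, smul_eq_mul, smul_eq_mul, mul_assoc,
          uHat_kernel_complex hp hpq]
        ring
      · rw [hx0, Pi.smul_apply, smul_eq_mul, inv_mul_cancel₀ hu0]
    · rw [hd' i h] at hi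
      exact absurd hi.symm (pow_ne_zero 2 hρ0)
  · intro R hR
    ext i k
    rw [diagonal_mul, mul_apply_eq_vecMul]
    by_cases h : (i : ℕ) < ℓ
    · rw [hB i h, hd i h, left_eigenvector_of_kernel hR (hz _) ?_ ⟨0, by omega⟩ (hx _), Pi.smul_apply, smul_eq_mul]
      rw [charpoly_roots hℓ hp hpq hR hr]
      exact Multiset.mem_add.2 (Or.inr (Multiset.mem_map.2 ⟨_, Finset.mem_univ_val _, rfl⟩))
    · rw [hB' i h, hd' i h, zero_mul, single_one_vecMul]
      simp [row_eq_zero hℓ hp hpq hR h]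

/-- The basis and the eigenvalues in `exists_diagonalisation` are chosen before R, so they determine
it. -/
lemma rateMatrix_unique (hℓ : 1 ≤ ℓ) (hp : 0 < p) (hpq : p < 1 - p)
    {R R' : Matrix (Phase ℓ) (Phase ℓ) ℝ} (hR : IsRateMatrix ℓ p R) (hR' : IsRateMatrix ℓ p R') :
    R = R' := by
  obtain ⟨B, d, hB, -, -, -, h⟩ := exists_diagonalisation hℓ hp hpq
  have h1 := hB.mul_left_cancel ((h R hR).trans (h R' hR').symm)
  exact map_injective (algebraMap ℝ ℂ).injective h1

lemma uHat_vecMul (hℓ : 1 ≤ ℓ) (hp : 0 < p) (hpq : p < 1 - p) (hR : IsRateMatrix ℓ p R) :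
    uHat ℓ p ᵥ* R = rho p ^ 2 • uHat ℓ p := by
  obtain ⟨B, d, -, -, ⟨i, hi⟩, hu, h⟩ := exists_diagonalisation hℓ hp hpq
  obtain ⟨c, hc, hc'⟩ := hu i hi
  ext k
  have h1 := congrFun (congrFun (h R hR) i) k
  rw [diagonal_mul, mul_apply_eq_vecMul, hc', hi, smul_vecMul, Pi.smul_apply, Pi.smul_apply,
    smul_eq_mul, smul_eq_mul, mul_left_comm] at h1
  have h2 := mul_left_cancel₀ hc h1
  simp only [vecMul, dotProduct, map_apply, Complex.coe_algebraMap] at h2 ⊢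
  exact_mod_cast h2

/-- The eigenspace of `ρ²` meets the hyperplane orthogonal to `û` trivially. -/
lemma eq_zero_of_eigenvector (hℓ : 1 ≤ ℓ) (hp : 0 < p) (hpq : p < 1 - p)
    (hR : IsRateMatrix ℓ p R) {w : Phase ℓ → ℝ} (hw : R *ᵥ w = rho p ^ 2 • w)
    (huw : uHat ℓ p ⬝ᵥ w = 0) : w = 0 := by
  obtain ⟨B, d, hB, -, -, hu, h⟩ := exists_diagonalisation hℓ hp hpq
  set wc : Phase ℓ → ℂ := fun i => (w i : ℂ) with hwc
  have hw1 : toComplex R *ᵥ wc = (rho p : ℂ) ^ 2 • wc := by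
    ext i
    have := congrFun hw i
    simp only [mulVec, dotProduct, map_apply, Complex.coe_algebraMap, hwc, Pi.smul_apply,
      smul_eq_mul] at this ⊢
    exact_mod_cast this
  -- In this basis an eigenvector for ρ² has only coordinates with d i = ρ², and those are multiples
  -- of û · w = 0.
  have hBw : B *ᵥ wc = 0 := by
    ext i
    by_cases hi : d i = (rho p : ℂ) ^ 2
    · obtain ⟨c, -, hc'⟩ := hu i hi
      have h2 : (fun k => (uHat ℓ p k : ℂ)) ⬝ᵥ wc = 0 := by
        simp only [dotProduct, hwc] at huw ⊢
        exact_mod_cast huw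
      rw [mulVec, hc', smul_dotProduct, h2, smul_zero, Pi.zero_apply]
    · have h1 : (B * toComplex R) *ᵥ wc = (diagonal d * B) *ᵥ wc := by rw [h R hR]
      rw [← mulVec_mulVec, ← mulVec_mulVec, hw1, mulVec_smul] at h1
      have h2 := congrFun h1 i
      rw [mulVec_diagonal, Pi.smul_apply, smul_eq_mul] at h2
      have h3 : (d i - (rho p : ℂ) ^ 2) * (B *ᵥ wc) i = 0 := by linear_combination -h2
      exact (mul_eq_zero.1 h3).resolve_left (sub_ne_zero.2 hi)
  have hwc0 : wc = 0 := mulVec_injective_iff_isUnit.2 hB (by simpa using hBw)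
  ext i
  exact Complex.ofReal_eq_zero.1 (congrFun hwc0 i)

lemma exists_unique_right_eigenvector (hℓ : 1 ≤ ℓ) (hp : 0 < p) (hpq : p < 1 - p)
    (hR : IsRateMatrix ℓ p R) : ∃! v : Phase ℓ → ℝ, IsRightEigenvector ℓ p R v := by
  have hu := uHat_vecMul hℓ hp hpq hR
  have hu0 : uHat ℓ p ≠ 0 := fun h =>
    (uHat_pos hp hpq (⟨0, by omega⟩ : Phase ℓ)).ne' (congrFun h _)
  have hdet : (R - rho p ^ 2 • (1 : Matrix (Phase ℓ) (Phase ℓ) ℝ)).det = 0 :=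
    exists_vecMul_eq_zero_iff.1 ⟨_, hu0, by rw [vecMul_sub, hu, vecMul_smul, vecMul_one, sub_self]⟩
  obtain ⟨w, hw0, hw⟩ := exists_mulVec_eq_zero_iff.2 hdet
  rw [sub_mulVec, smul_mulVec, one_mulVec, sub_eq_zero] at hw
  have hne : uHat ℓ p ⬝ᵥ w ≠ 0 := fun h => hw0 (eq_zero_of_eigenvector hℓ hp hpq hR hw h)
  refine ⟨(uHat ℓ p ⬝ᵥ w)⁻¹ • w, ⟨?_, ?_⟩, ?_⟩
  · rw [mulVec_smul, hw, smul_comm]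
  · rw [dotProduct_smul, smul_eq_mul, inv_mul_cancel₀ hne]
  · rintro v ⟨hv, hv1⟩
    refine sub_eq_zero.1 (eq_zero_of_eigenvector hℓ hp hpq hR ?_ ?_)
    · rw [mulVec_sub, mulVec_smul, hw, hv, smul_comm, smul_sub]
    · rw [dotProduct_sub, hv1, dotProduct_smul, smul_eq_mul, inv_mul_cancel₀ hne, sub_self]

/-- Powers of the rate matrix on the hyperplane orthogonal to `û`. -/
lemma dotProduct_pow_isLittleO (hℓ : 1 ≤ ℓ) (hp : 0 < p) (hpq : p < 1 - p)
    (hR : IsRateMatrix ℓ p R) (g : Phase ℓ → ℝ) {w : Phase ℓ → ℝ} (huw : uHat ℓ p ⬝ᵥ w = 0) :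
    (fun k : ℕ => (g ᵥ* R ^ k) ⬝ᵥ w) =o[atTop] fun k : ℕ => rho p ^ (2 * k) := by
  obtain ⟨B, d, hB, hd, -, hu, h⟩ := exists_diagonalisation hℓ hp hpq
  set wc : Phase ℓ → ℂ := fun i => (w i : ℂ) with hwc
  obtain ⟨a, ha⟩ := vecMul_surjective_iff_isUnit.2 hB (fun i => (g i : ℂ))
  have hpow : ∀ k : ℕ, B * toComplex R ^ k = diagonal (fun i => d i ^ k) * B := by
    intro k
    induction k with
    | zero => simp
    | succ k ih =>
      rw [pow_succ, ← mul_assoc, ih, mul_assoc, h R hR, ← mul_assoc, diagonal_mul_diagonal]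
      simp only [pow_succ]
  -- In this expansion the terms with d i = ρ² vanish by orthogonality to û; all the others decay
  -- strictly faster.
  have key : ∀ k : ℕ, (((g ᵥ* R ^ k) ⬝ᵥ w : ℝ) : ℂ) = ∑ i, a i * (B *ᵥ wc) i * d i ^ k := by
    intro k
    have h1 : (((g ᵥ* R ^ k) ⬝ᵥ w : ℝ) : ℂ)
        = ((fun i => (g i : ℂ)) ᵥ* toComplex R ^ k) ⬝ᵥ wc := by
      have h2 : toComplex R ^ k = (R ^ k).map (algebraMap ℝ ℂ) :=
        (map_pow (algebraMap ℝ ℂ).mapMatrix R k).symm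
      rw [h2]
      simp [dotProduct, vecMul, hwc]
    rw [h1, ← ha]
    change ((a ᵥ* B) ᵥ* toComplex R ^ k) ⬝ᵥ wc = _
    rw [vecMul_vecMul, hpow, ← vecMul_vecMul, ← dotProduct_mulVec]
    simp only [dotProduct, vecMul_diagonal]
    exact Finset.sum_congr rfl fun i _ => by ring
  have hC : (fun k : ℕ => (((g ᵥ* R ^ k) ⬝ᵥ w : ℝ) : ℂ))
      =o[atTop] fun k : ℕ => rho p ^ (2 * k) := by
    simp only [key]
    refine IsLittleO.fun_sum (s := Finset.univ) (A := fun i (k : ℕ) => a i * (B *ᵥ wc) i * d i ^ k)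
      fun i _ => ?_
    by_cases hi : d i = (rho p : ℂ) ^ 2
    · obtain ⟨c, -, hc'⟩ := hu i hi
      have h2 : (fun k => (uHat ℓ p k : ℂ)) ⬝ᵥ wc = 0 := by
        simp only [dotProduct, hwc] at huw ⊢
        exact_mod_cast huw
      have h3 : (B *ᵥ wc) i = 0 := by rw [mulVec, hc', smul_dotProduct, h2, smul_zero]
      simp only [h3, mul_zero, zero_mul]
      exact isLittleO_zero _ _
    · refine IsLittleO.const_mul_left ?_ _
      simp only [pow_mul]
      rw [← isLittleO_norm_left]
      simp only [norm_pow]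
      exact isLittleO_pow_pow_of_lt_left (norm_nonneg _) (hd i hi)
  have hn := hC.norm_left
  simp only [Complex.norm_real] at hn
  exact isLittleO_norm_left.1 hn

end Diagonalisation

/-! ### Existence of the rate matrix -/

section Existence

variable {ℓ : ℕ} {p : ℝ}

lemma wDown_nonneg (hp : 0 < p) (hpq : p < 1 - p) (i : Phase ℓ) : 0 ≤ wDown ℓ p i := by
  unfold wDown; split_ifs <;> linarith

lemma wStay_nonneg (hp : 0 < p) (hpq : p < 1 - p) (i : Phase ℓ) : 0 ≤ wStay ℓ p i := by
  unfold wStay; split_ifs <;> linarith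

lemma wUp_nonneg (hp : 0 < p) (i : Phase ℓ) : 0 ≤ wUp ℓ p i := by
  unfold wUp; split_ifs <;> linarith

lemma cyclic_nonneg {c : Phase ℓ → ℝ} (hc : ∀ i, 0 ≤ c i) (i j : Phase ℓ) : 0 ≤ cyclic c i j := by
  simp only [cyclic, of_apply]
  split_ifs
  exacts [hc i, le_rfl]

lemma blockDown_nonneg (hp : 0 < p) (hpq : p < 1 - p) (i j : Phase ℓ) : 0 ≤ blockDown ℓ p i j :=
  blockDown_eq ℓ p ▸ cyclic_nonneg (wDown_nonneg hp hpq) i j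

lemma blockStay_nonneg (hp : 0 < p) (hpq : p < 1 - p) (i j : Phase ℓ) : 0 ≤ blockStay ℓ p i j :=
  blockStay_eq ℓ p ▸ cyclic_nonneg (wStay_nonneg hp hpq) i j

lemma blockUp_nonneg (hp : 0 < p) (i j : Phase ℓ) : 0 ≤ blockUp ℓ p i j :=
  blockUp_eq ℓ p ▸ cyclic_nonneg (wUp_nonneg hp) i j

lemma mul_apply_nonneg {m : Type*} [Fintype m] {A B : Matrix m m ℝ} (hA : ∀ i j, 0 ≤ A i j)
    (hB : ∀ i j, 0 ≤ B i j) (i j : m) : 0 ≤ (A * B) i j :=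
  Finset.sum_nonneg fun k _ => mul_nonneg (hA i k) (hB k j)

lemma mul_apply_mono {m : Type*} [Fintype m] {A A' B B' : Matrix m m ℝ} (hB0 : ∀ i j, 0 ≤ B i j)
    (hA0 : ∀ i j, 0 ≤ A' i j) (hA : ∀ i j, A i j ≤ A' i j) (hB : ∀ i j, B i j ≤ B' i j) (i j : m) :
    (A * B) i j ≤ (A' * B') i j :=
  Finset.sum_le_sum fun k _ => mul_le_mul (hA i k) (hB k j) (hB0 k j) (hA0 i k)

lemma vecMul_mono {m : Type*} [Fintype m] {x y : m → ℝ} {A : Matrix m m ℝ} (hA : ∀ i j, 0 ≤ A i j)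
    (h : x ≤ y) : x ᵥ* A ≤ y ᵥ* A :=
  fun j => Finset.sum_le_sum fun i _ => mul_le_mul_of_nonneg_right (h i) (hA i j)

/-- Successive approximations of the rate matrix. -/
def approx (ℓ : ℕ) (p : ℝ) : ℕ → Matrix (Phase ℓ) (Phase ℓ) ℝ
  | 0 => 0
  | n + 1 => approx ℓ p n ^ 2 * blockDown ℓ p + approx ℓ p n * blockStay ℓ p + blockUp ℓ p

lemma approx_nonneg (hp : 0 < p) (hpq : p < 1 - p) (n : ℕ) (i j : Phase ℓ) :
    0 ≤ approx ℓ p n i j := by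
  induction n generalizing i j with
  | zero => exact le_rfl
  | succ n ih =>
    rw [approx, pow_two]
    exact add_nonneg (add_nonneg (mul_apply_nonneg (mul_apply_nonneg ih ih)
      (blockDown_nonneg hp hpq) i j) (mul_apply_nonneg ih (blockStay_nonneg hp hpq) i j))
      (blockUp_nonneg hp i j)

lemma approx_le_succ (hp : 0 < p) (hpq : p < 1 - p) (n : ℕ) (i j : Phase ℓ) :
    approx ℓ p n i j ≤ approx ℓ p (n + 1) i j := by
  induction n generalizing i j with
  | zero => exact approx_nonneg hp hpq 1 i j
  | succ n ih =>
    have h0 := approx_nonneg (ℓ := ℓ) hp hpq n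
    have h1 := approx_nonneg (ℓ := ℓ) hp hpq (n + 1)
    rw [approx, approx.eq_2 ℓ p (n + 1), pow_two, pow_two]
    exact add_le_add_left (add_le_add
      (mul_apply_mono (blockDown_nonneg hp hpq) (mul_apply_nonneg h1 h1)
        (mul_apply_mono h0 h1 ih ih) (fun _ _ => le_rfl) i j)
      (mul_apply_mono (blockStay_nonneg hp hpq) h1 ih (fun _ _ => le_rfl) i j)) _

/-- For a null vector, zx = z²xA₋₁ + zxA₀ + xA₁, so the bound reproduces itself under the monotone
iteration. -/
lemma vecMul_approx_le (hp : 0 < p) (hpq : p < 1 - p) {x : Phase ℓ → ℝ} {z : ℝ} (hz : 0 ≤ z)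
    (hx0 : 0 ≤ x) (hx : ∀ i, x i * wPencil ℓ p z i = z * x (next ℓ i)) (n : ℕ) :
    x ᵥ* approx ℓ p n ≤ z • x := by
  induction n with
  | zero =>
    rw [approx, vecMul_zero]
    exact smul_nonneg hz hx0
  | succ n ih =>
    have h1 : (x ᵥ* approx ℓ p n) ᵥ* approx ℓ p n ≤ z ^ 2 • x := by
      refine (vecMul_mono (approx_nonneg hp hpq n) ih).trans ?_
      rw [smul_vecMul, pow_two, mul_smul]
      exact smul_le_smul_of_nonneg_left ih hz
    have h2 : z • x = (z ^ 2 • x) ᵥ* blockDown ℓ p + (z • x) ᵥ* blockStay ℓ p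
        + x ᵥ* blockUp ℓ p := by
      ext j
      obtain ⟨i, rfl⟩ := (next ℓ).surjective j
      rw [blockDown_eq, blockStay_eq, blockUp_eq]
      simp only [Pi.add_apply, vecMul_cyclic, Pi.smul_apply, smul_eq_mul, ← hx i, wPencil,
        Algebra.algebraMap_self, RingHom.id_apply]
      ring
    rw [approx, vecMul_add, vecMul_add, pow_two, ← vecMul_vecMul, ← vecMul_vecMul, ← vecMul_vecMul,
      h2]
    exact add_le_add_left (add_le_add (vecMul_mono (blockDown_nonneg hp hpq) h1)
      (vecMul_mono (blockStay_nonneg hp hpq) ih)) _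

/-- The spectral radius of a non-negative matrix with a positive subinvariant vector. -/
lemma norm_le_of_mem_spectrum {R : Matrix (Phase ℓ) (Phase ℓ) ℝ} (hR : ∀ i j, 0 ≤ R i j)
    {x : Phase ℓ → ℝ} {r : ℝ} (hx : ∀ i, 0 < x i) (hxR : x ᵥ* R ≤ r • x) {z : ℂ}
    (hz : z ∈ spectrum ℂ (toComplex R)) : ‖z‖ ≤ r := by
  rw [mem_spectrum_iff_isRoot_charpoly, Polynomial.IsRoot, eval_charpoly, scalar_apply,
    ← smul_one_eq_diagonal] at hz
  obtain ⟨y, hy0, hy⟩ := exists_mulVec_eq_zero_iff.2 hz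
  rw [sub_mulVec, smul_mulVec, one_mulVec, sub_eq_zero] at hy
  have h1 : ∀ i, ‖z‖ * ‖y i‖ ≤ (R *ᵥ fun k => ‖y k‖) i := by
    intro i
    rw [← norm_mul, ← smul_eq_mul, ← Pi.smul_apply, hy]
    refine (norm_sum_le Finset.univ fun k => toComplex R i k * y k).trans_eq (Finset.sum_congr rfl fun k _ => ?_)
    have hn : ‖toComplex R i k‖ = R i k := (Complex.norm_real _).trans (Real.norm_of_nonneg (hR i k))
    rw [norm_mul, hn]
  -- Pairing |z||y| ≤ R|y| with x gives a factor x · |y|, positive because x is, that can be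
  -- cancelled.
  have h2 : ‖z‖ * (x ⬝ᵥ fun k => ‖y k‖) ≤ r * (x ⬝ᵥ fun k => ‖y k‖) := by
    calc ‖z‖ * (x ⬝ᵥ fun k => ‖y k‖) = ∑ i, x i * (‖z‖ * ‖y i‖) := by
          rw [dotProduct, Finset.mul_sum]
          exact Finset.sum_congr rfl fun i _ => by ring
      _ ≤ x ⬝ᵥ (R *ᵥ fun k => ‖y k‖) :=
          Finset.sum_le_sum fun i _ => mul_le_mul_of_nonneg_left (h1 i) (hx i).le
      _ = (x ᵥ* R) ⬝ᵥ fun k => ‖y k‖ := dotProduct_mulVec _ _ _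
      _ ≤ (r • x) ⬝ᵥ fun k => ‖y k‖ :=
          Finset.sum_le_sum fun i _ => mul_le_mul_of_nonneg_right (hxR i) (norm_nonneg _)
      _ = r * (x ⬝ᵥ fun k => ‖y k‖) := by rw [smul_dotProduct, smul_eq_mul]
  refine le_of_mul_le_mul_right h2 ?_
  obtain ⟨i, hi⟩ := Function.ne_iff.1 hy0
  exact Finset.sum_pos' (fun k _ => mul_nonneg (hx k).le (norm_nonneg _))
    ⟨i, Finset.mem_univ i, mul_pos (hx i) (norm_pos_iff.2 hi)⟩

/-- Null vectors serve twice: û at z = ρ² bounds the spectral radius, and 1 at z = 1 bounds the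
entries. The latter bound is retained because it makes 1ᵀ(I - R) non-negative. -/
lemma exists_rateMatrix (hp : 0 < p) (hpq : p < 1 - p) :
    ∃ R, IsRateMatrix ℓ p R ∧ (1 : Phase ℓ → ℝ) ᵥ* R ≤ 1 := by
  have hu := vecMul_approx_le hp hpq (sq_nonneg (rho p)) (fun i => (uHat_pos hp hpq i).le)
    (uHat_kernel (ℓ := ℓ) hp hpq)
  have h1 := vecMul_approx_le (x := (1 : Phase ℓ → ℝ)) hp hpq zero_le_one zero_le_one (fun i => by
    have := w_sum ℓ p i
    simpa [wPencil] using this)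
  have hbdd : ∀ i j : Phase ℓ, ∃ b, ∀ n, approx ℓ p n i j ≤ b := by
    intro i j
    refine ⟨1, fun n => ?_⟩
    have h2 := h1 n j
    simp only [vecMul, dotProduct, Pi.one_apply, one_mul, Pi.smul_apply, one_smul] at h2
    exact (Finset.single_le_sum (f := fun i => approx ℓ p n i j)
      (fun k _ => approx_nonneg hp hpq n k j) (Finset.mem_univ i)).trans h2
  let R : Matrix (Phase ℓ) (Phase ℓ) ℝ := of fun i j => ⨆ n, approx ℓ p n i j
  have hlim : Tendsto (approx ℓ p) atTop (𝓝 R) := by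
    refine tendsto_pi_nhds.2 fun i => tendsto_pi_nhds.2 fun j => ?_
    refine tendsto_atTop_ciSup (monotone_nat_of_le_succ fun n => approx_le_succ hp hpq n i j) ?_
    obtain ⟨b, hb⟩ := hbdd i j
    exact ⟨b, by rintro _ ⟨n, rfl⟩; exact hb n⟩
  have hnonneg : ∀ i j, 0 ≤ R i j := fun i j => Real.iSup_nonneg fun n => approx_nonneg hp hpq n i j
  have hvec : ∀ x : Phase ℓ → ℝ, Tendsto (fun n => x ᵥ* approx ℓ p n) atTop (𝓝 (x ᵥ* R)) :=
    fun x => ((continuous_const.matrix_vecMul continuous_id).tendsto R).comp hlim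
  refine ⟨R, ⟨hnonneg, ?_, ?_⟩, ?_⟩
  · have h2 : Tendsto (fun n => approx ℓ p (n + 1)) atTop
        (𝓝 (R ^ 2 * blockDown ℓ p + R * blockStay ℓ p + blockUp ℓ p)) :=
      (((hlim.pow 2).mul_const _).add (hlim.mul_const _)).add_const _
    have h3 := tendsto_nhds_unique h2 (hlim.comp (tendsto_add_atTop_nat 1))
    rw [mul_sub, mul_one, add_sub_assoc', sub_add_eq_add_sub, h3, sub_self]
  · intro z hz
    exact (norm_le_of_mem_spectrum hnonneg (uHat_pos hp hpq)
      (le_of_tendsto' (hvec _) hu) hz).trans_lt (rho_sq_lt_one hp hpq)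
  · exact le_of_tendsto' (hvec _) fun n => (h1 n).trans_eq (one_smul _ _)

end Existence

/-! ### Stationary vectors -/

section Stationary

variable {ℓ : ℕ} {p : ℝ} {R : Matrix (Phase ℓ) (Phase ℓ) ℝ} {γ : State ℓ → ℝ}

/-- The part of `γ` at the level `k`. -/
def level (γ : State ℓ → ℝ) (k : ℕ) : Phase ℓ → ℝ := fun i => γ (k, i)

lemma hasSum_transition_zero (γ : State ℓ → ℝ) (j : Phase ℓ) :
    HasSum (fun s => γ s * transition ℓ p s (0, j))
      ((level γ 0 ᵥ* blockBoundary ℓ p + level γ 1 ᵥ* blockDown ℓ p) j) := by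
  have h := hasSum_sum_of_ne_finset_zero (f := fun s => γ s * transition ℓ p s (0, j))
    (s := ({0, 1} : Finset ℕ) ×ˢ Finset.univ) (L := SummationFilter.unconditional _) (by
      rintro ⟨n, i⟩ hn
      simp only [Finset.mem_product, Finset.mem_insert, Finset.mem_singleton, Finset.mem_univ,
        and_true, not_or] at hn
      simp only [transition, of_apply]
      rw [if_neg (by omega), if_neg (by omega), if_neg (by omega), mul_zero])
  convert h using 1
  rw [Finset.sum_product, Finset.sum_pair (by norm_num)]
  simp [transition, vecMul, dotProduct, level]

lemma hasSum_transition_succ (γ : State ℓ → ℝ) (k : ℕ) (j : Phase ℓ) :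
    HasSum (fun s => γ s * transition ℓ p s (k + 1, j))
      ((level γ k ᵥ* blockUp ℓ p + level γ (k + 1) ᵥ* blockStay ℓ p
        + level γ (k + 2) ᵥ* blockDown ℓ p) j) := by
  have h := hasSum_sum_of_ne_finset_zero (f := fun s => γ s * transition ℓ p s (k + 1, j))
    (s := ({k, k + 1, k + 2} : Finset ℕ) ×ˢ Finset.univ)
    (L := SummationFilter.unconditional _) (by
      rintro ⟨n, i⟩ hn
      simp only [Finset.mem_product, Finset.mem_insert, Finset.mem_singleton, Finset.mem_univ,
        and_true, not_or] at hn
      simp only [transition, of_apply]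
      rw [if_neg (by omega), if_neg (by omega), if_neg (by omega), mul_zero])
  convert h using 1
  rw [Finset.sum_product, Finset.sum_insert (by simp), Finset.sum_pair (by simp)]
  simp [transition, vecMul, dotProduct, level, add_assoc]

lemma det_one_sub_ne_zero (hR : IsRateMatrix ℓ p R) : (1 - R).det ≠ 0 := by
  intro h
  have h1 : (1 : ℂ) ∈ spectrum ℂ (toComplex R) := by
    rw [mem_spectrum_iff_isRoot_charpoly, Polynomial.IsRoot, eval_charpoly, map_one]
    have h2 := congrArg (algebraMap ℝ ℂ) h
    rw [RingHom.map_det, map_sub, map_one, map_zero] at h2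
    exact h2
  simpa using hR.eigenvalues 1 h1

/-- At z = 1 the weights add up to one and the pencil is a cyclic permutation matrix minus I, whose
left null vectors are constant. -/
lemma factorization_one
    (h : R ^ 2 * blockDown ℓ p + R * (blockStay ℓ p - 1) + blockUp ℓ p = 0) :
    (1 - R) * (blockDown ℓ p + cofactor ℓ p R) = diagonal (fun _ => -1) + cyclic fun _ => 1 := by
  have h1 := factorization_map h (1 : ℝ)
  have h2 : wPencil ℓ p (1 : ℝ) = fun _ => 1 := by
    ext i
    simpa [wPencil] using w_sum ℓ p i
  rw [h2] at h1
  simpa [Matrix.map_id'] using h1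

/-- I - R can be cancelled in `factorization_one` applied to 1. With U = A₀ + RA₋₁ this says that
A₋₁ + U has unit row sums. -/
lemma blockDown_add_cofactor_mulVec (hR : IsRateMatrix ℓ p R) :
    (blockDown ℓ p + cofactor ℓ p R) *ᵥ 1 = 0 := by
  have h := congrArg (· *ᵥ (1 : Phase ℓ → ℝ)) (factorization_one hR.equation)
  simp only [← mulVec_mulVec, add_mulVec (diagonal _), cyclic_mulVec_one] at h
  refine eq_zero_of_mulVec_eq_zero (det_one_sub_ne_zero hR) (h.trans ?_)
  ext i
  simp

lemma abs_vecMul_le {m : Type*} [Fintype m] {A : Matrix m m ℝ} (hA : ∀ i j, 0 ≤ A i j)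
    (x : m → ℝ) (j : m) : |(x ᵥ* A) j| ≤ (|x| ᵥ* A) j := by
  simp only [vecMul, dotProduct]
  refine (Finset.abs_sum_le_sum_abs _ _).trans_eq (Finset.sum_congr rfl fun i _ => ?_)
  rw [abs_mul, abs_of_nonneg (hA i j), Pi.abs_apply]

/-- The defect of the relation `γ_{k+1} = γ_k R` vanishes as soon as it tends to zero. -/
lemma eq_zero_of_recursion (hℓ : 1 ≤ ℓ) (hp : 0 < p) (hpq : p < 1 - p) (hR : IsRateMatrix ℓ p R)
    {δ : ℕ → Phase ℓ → ℝ}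
    (hδ : ∀ k, δ (k + 1) ᵥ* blockDown ℓ p + δ k ᵥ* cofactor ℓ p R = 0)
    (hlim : ∀ i, Tendsto (fun k => δ k i) atTop (𝓝 0)) (k : ℕ) : δ k = 0 := by
  set U := blockStay ℓ p + R * blockDown ℓ p with hU
  have hCU : cofactor ℓ p R = U - 1 := by rw [cofactor, hU]; abel
  have hU0 : ∀ i j, 0 ≤ U i j := fun i j => add_nonneg (blockStay_nonneg hp hpq i j)
    (mul_apply_nonneg hR.nonneg (blockDown_nonneg hp hpq) i j)
  have hD1 : blockDown ℓ p *ᵥ 1 = wDown ℓ p := by rw [blockDown_eq, cyclic_mulVec_one]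
  have hU1 : U *ᵥ 1 = 1 - wDown ℓ p := by
    have h := blockDown_add_cofactor_mulVec hR
    rw [hCU, add_mulVec, sub_mulVec, one_mulVec, hD1] at h
    linear_combination h
  have hrec : ∀ k, δ k = δ k ᵥ* U + δ (k + 1) ᵥ* blockDown ℓ p := by
    intro k
    have h := hδ k
    rw [hCU, vecMul_sub, vecMul_one] at h
    linear_combination -h
  -- As U1 = 1 - A₋₁1, summing |δ_k| ≤ |δ_k|U + |δ_{k+1}|A₋₁ over the phases leaves a_k ≤ a_{k+1}. A
  -- non-negative increasing sequence tending to 0 is zero.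
  set a : ℕ → ℝ := fun k => |δ k| ⬝ᵥ wDown ℓ p with ha
  have habs : ∀ k j, |δ k| j ≤ (|δ k| ᵥ* U + |δ (k + 1)| ᵥ* blockDown ℓ p) j := by
    intro k j
    rw [Pi.abs_apply]
    nth_rewrite 1 [hrec k]
    exact (abs_add_le _ _).trans (add_le_add (abs_vecMul_le hU0 _ j)
      (abs_vecMul_le (blockDown_nonneg hp hpq) _ j))
  have hmono : Monotone a := by
    refine monotone_nat_of_le_succ fun k => ?_
    have h1 : |δ k| ⬝ᵥ 1 ≤ (|δ k| ᵥ* U + |δ (k + 1)| ᵥ* blockDown ℓ p) ⬝ᵥ 1 :=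
      Finset.sum_le_sum fun j _ => mul_le_mul_of_nonneg_right (habs k j) zero_le_one
    rw [add_dotProduct, ← dotProduct_mulVec, ← dotProduct_mulVec, hU1, hD1, dotProduct_sub] at h1
    simp only [ha]
    linarith
  have ha0 : Tendsto a atTop (𝓝 0) := by
    have : Tendsto a atTop (𝓝 (∑ i, |(0 : ℝ)| * wDown ℓ p i)) :=
      tendsto_finsetSum _ fun i _ => ((hlim i).abs).mul_const _
    simpa using this
  have hzero : ∀ k i, δ k i * wDown ℓ p i = 0 := by
    intro k
    have h1 : a k ≤ 0 := hmono.ge_of_tendsto ha0 k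
    have hnn : ∀ i ∈ Finset.univ, 0 ≤ |δ k| i * wDown ℓ p i :=
      fun i _ => mul_nonneg (abs_nonneg _) (wDown_nonneg hp hpq i)
    have h2 := (Finset.sum_eq_zero_iff_of_nonneg hnn).1 (le_antisymm h1 (Finset.sum_nonneg hnn))
    intro i
    rcases mul_eq_zero.1 (h2 i (Finset.mem_univ i)) with h | h
    · rw [abs_eq_zero.1 h, zero_mul]
    · rw [h, mul_zero]
  have hdown : ∀ k, δ k ᵥ* blockDown ℓ p = 0 := by
    intro k
    ext j
    obtain ⟨i, rfl⟩ := (next ℓ).surjective j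
    rw [blockDown_eq, vecMul_cyclic, hzero, Pi.zero_apply]
  refine eq_zero_of_vecMul_eq_zero (det_cofactor_ne_zero hℓ hp hpq hR) ?_
  simpa [hdown] using hδ k

/-- The unnormalised stationary vector `1ᵀ (1 - R) Rᵏ`. -/
def geometric (R : Matrix (Phase ℓ) (Phase ℓ) ℝ) : State ℓ → ℝ :=
  fun s => ((1 : Phase ℓ → ℝ) ᵥ* ((1 - R) * R ^ s.1)) s.2

lemma level_smul_geometric (c : ℝ) (R : Matrix (Phase ℓ) (Phase ℓ) ℝ) (k : ℕ) :
    level (c • geometric R) k = c • (1 : Phase ℓ → ℝ) ᵥ* ((1 - R) * R ^ k) := rfl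

lemma pow_apply_nonneg {R : Matrix (Phase ℓ) (Phase ℓ) ℝ} (hR : ∀ i j, 0 ≤ R i j) (n : ℕ)
    (i j : Phase ℓ) : 0 ≤ (R ^ n) i j := by
  induction n generalizing i j with
  | zero =>
    rw [pow_zero, one_apply]
    split_ifs <;> norm_num
  | succ n ih => rw [pow_succ]; exact mul_apply_nonneg ih hR i j

/-- Positivity gives û_i (Rⁿ)_ij ≤ (ûᵀRⁿ)_j = ρ^(2n) û_j. -/
lemma tendsto_vecMul_pow (hℓ : 1 ≤ ℓ) (hp : 0 < p) (hpq : p < 1 - p) (hR : IsRateMatrix ℓ p R)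
    (j : Phase ℓ) : Tendsto (fun n : ℕ => ((1 : Phase ℓ → ℝ) ᵥ* R ^ n) j) atTop (𝓝 0) := by
  have hu : ∀ n : ℕ, uHat ℓ p ᵥ* R ^ n = (rho p ^ 2) ^ n • uHat ℓ p := by
    intro n
    induction n with
    | zero => simp
    | succ n ih =>
      rw [pow_succ R, ← vecMul_vecMul, ih, smul_vecMul, uHat_vecMul hℓ hp hpq hR, smul_smul,
        pow_succ (rho p ^ 2)]
  have hentry : ∀ i, Tendsto (fun n : ℕ => (R ^ n) i j) atTop (𝓝 0) := by
    intro i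
    have hui := uHat_pos hp hpq i
    have hz : Tendsto (fun n : ℕ => (rho p ^ 2) ^ n * (uHat ℓ p j / uHat ℓ p i)) atTop (𝓝 0) := by
      have := (tendsto_pow_atTop_nhds_zero_of_lt_one (sq_nonneg (rho p))
        (rho_sq_lt_one hp hpq)).mul_const (uHat ℓ p j / uHat ℓ p i)
      rwa [zero_mul] at this
    refine squeeze_zero (fun n => pow_apply_nonneg hR.nonneg n i j) (fun n => ?_) hz
    have h1 := congrFun (hu n) j
    have h2 : uHat ℓ p i * (R ^ n) i j ≤ (uHat ℓ p ᵥ* R ^ n) j :=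
      Finset.single_le_sum (f := fun i => uHat ℓ p i * (R ^ n) i j)
        (fun k _ => mul_nonneg (uHat_pos hp hpq k).le (pow_apply_nonneg hR.nonneg n k j))
        (Finset.mem_univ i)
    rw [h1, Pi.smul_apply, smul_eq_mul] at h2
    rw [← mul_div_assoc, le_div_iff₀ hui, mul_comm]
    exact h2
  have := tendsto_finsetSum Finset.univ fun i _ => hentry i
  simpa [vecMul, dotProduct] using this

lemma one_vecMul_le (hℓ : 1 ≤ ℓ) (hp : 0 < p) (hpq : p < 1 - p) (hR : IsRateMatrix ℓ p R) :
    (1 : Phase ℓ → ℝ) ᵥ* R ≤ 1 := by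
  obtain ⟨R', hR', h⟩ := exists_rateMatrix (ℓ := ℓ) hp hpq
  rwa [rateMatrix_unique hℓ hp hpq hR hR']

lemma geometric_nonneg (hℓ : 1 ≤ ℓ) (hp : 0 < p) (hpq : p < 1 - p) (hR : IsRateMatrix ℓ p R)
    (s : State ℓ) : 0 ≤ geometric R s := by
  have h1 : 0 ≤ (1 : Phase ℓ → ℝ) ᵥ* (1 - R) := by
    rw [vecMul_sub, vecMul_one, sub_nonneg]
    exact one_vecMul_le hℓ hp hpq hR
  rw [geometric, ← vecMul_vecMul]
  have h2 := vecMul_mono (pow_apply_nonneg hR.nonneg s.1) h1 s.2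
  rwa [zero_vecMul] at h2

/-- The sum over levels telescopes to 1 in each of the 2ℓ phases. -/
lemma hasSum_geometric (hℓ : 1 ≤ ℓ) (hp : 0 < p) (hpq : p < 1 - p) (hR : IsRateMatrix ℓ p R) :
    HasSum (geometric R) (2 * ℓ) := by
  have h0 := geometric_nonneg hℓ hp hpq hR
  have hcol : ∀ i, HasSum (fun k => geometric R (k, i)) 1 := by
    intro i
    rw [hasSum_iff_tendsto_nat_of_nonneg fun k => h0 (k, i)]
    have hpart : ∀ n : ℕ, ∑ k ∈ Finset.range n, geometric R (k, i)
        = 1 - ((1 : Phase ℓ → ℝ) ᵥ* R ^ n) i := by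
      intro n
      induction n with
      | zero => simp
      | succ n ih =>
        rw [Finset.sum_range_succ, ih, geometric, sub_mul, one_mul, ← pow_succ', vecMul_sub,
          Pi.sub_apply]
        ring
    simp only [hpart]
    simpa using (tendsto_vecMul_pow hℓ hp hpq hR i).const_sub 1
  have hmarg : HasSum (fun k => ∑ i, geometric R (k, i)) (2 * ℓ : ℝ) := by
    have := hasSum_sum (s := Finset.univ) fun i _ => hcol i
    simpa using this
  have hsum : Summable (geometric R) := by
    rw [summable_prod_of_nonneg h0]
    refine ⟨fun k => Summable.of_finite, ?_⟩
    simp only [tsum_fintype]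
    exact hmarg.summable
  have h1 := hsum.hasSum.prod_fiberwise fun k => hasSum_fintype fun i => geometric R (k, i)
  rw [← h1.unique hmarg]
  exact hsum.hasSum

lemma isStationary_geometric (hℓ : 1 ≤ ℓ) (hp : 0 < p) (hpq : p < 1 - p)
    (hR : IsRateMatrix ℓ p R) : IsStationary ℓ p ((2 * ℓ : ℝ)⁻¹ • geometric R) := by
  have hℓ0 : (0 : ℝ) < 2 * ℓ := by
    have : (0 : ℝ) < ℓ := by exact_mod_cast hℓ
    positivity
  refine ⟨fun s => mul_nonneg (inv_nonneg.2 hℓ0.le) (geometric_nonneg hℓ hp hpq hR s), ?_, ?_⟩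
  · have := (hasSum_geometric hℓ hp hpq hR).mul_left (2 * ℓ : ℝ)⁻¹
    rwa [inv_mul_cancel₀ hℓ0.ne'] at this
  · rintro ⟨_ | k, j⟩
    · have h : level ((2 * ℓ : ℝ)⁻¹ • geometric R) 0 ᵥ* blockBoundary ℓ p
          + level ((2 * ℓ : ℝ)⁻¹ • geometric R) 1 ᵥ* blockDown ℓ p
          = level ((2 * ℓ : ℝ)⁻¹ • geometric R) 0 := by
        have h1 : (1 : Phase ℓ → ℝ) ᵥ* ((1 - R) * (blockDown ℓ p + cofactor ℓ p R)) = 0 := by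
          rw [factorization_one hR.equation, vecMul_pencil_eq_zero]
          simp
        -- The balance at level 0 thus reduces to 1 being a left null vector of the pencil at z = 1.
        have h2 : (1 - R) * blockBoundary ℓ p + (1 - R) * R * blockDown ℓ p
            = (1 - R) + (1 - R) * (blockDown ℓ p + cofactor ℓ p R) := by
          rw [cofactor, blockBoundary]
          noncomm_ring
        rw [level_smul_geometric, level_smul_geometric, smul_vecMul, smul_vecMul, ← smul_add,
          vecMul_vecMul, vecMul_vecMul, ← vecMul_add, pow_zero, mul_one, pow_one, h2, vecMul_add,
          h1, add_zero]
      have h3 := hasSum_transition_zero (p := p) ((2 * ℓ : ℝ)⁻¹ • geometric R) j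
      rw [h] at h3
      exact h3
    · have h : level ((2 * ℓ : ℝ)⁻¹ • geometric R) k ᵥ* blockUp ℓ p
          + level ((2 * ℓ : ℝ)⁻¹ • geometric R) (k + 1) ᵥ* blockStay ℓ p
          + level ((2 * ℓ : ℝ)⁻¹ • geometric R) (k + 2) ᵥ* blockDown ℓ p
          = level ((2 * ℓ : ℝ)⁻¹ • geometric R) (k + 1) := by
        have h2 : (1 - R) * R ^ k * blockUp ℓ p + (1 - R) * R ^ (k + 1) * blockStay ℓ p
            + (1 - R) * R ^ (k + 2) * blockDown ℓ p = (1 - R) * R ^ (k + 1)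
            + (1 - R) * R ^ k * (R ^ 2 * blockDown ℓ p + R * (blockStay ℓ p - 1)
              + blockUp ℓ p) := by
          rw [pow_add R k 2, pow_succ R k]
          noncomm_ring
        rw [hR.equation, mul_zero, add_zero] at h2
        rw [level_smul_geometric, level_smul_geometric, level_smul_geometric, smul_vecMul,
          smul_vecMul, smul_vecMul, ← smul_add, ← smul_add, vecMul_vecMul, vecMul_vecMul,
          vecMul_vecMul, ← vecMul_add, ← vecMul_add, h2]
      have h3 := hasSum_transition_succ (p := p) ((2 * ℓ : ℝ)⁻¹ • geometric R) k j
      rw [h] at h3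
      exact h3

/-- The factorisation of the pencil turns the second-order balance equations into a first-order
recursion for the defect, which tends to 0 because γ is summable. -/
lemma IsStationary.level_succ (hℓ : 1 ≤ ℓ) (hp : 0 < p) (hpq : p < 1 - p)
    (hR : IsRateMatrix ℓ p R) (hγ : IsStationary ℓ p γ) (k : ℕ) :
    level γ (k + 1) = level γ k ᵥ* R := by
  have hbal : ∀ k, level γ (k + 1) = level γ k ᵥ* blockUp ℓ p
      + level γ (k + 1) ᵥ* blockStay ℓ p + level γ (k + 2) ᵥ* blockDown ℓ p := fun k =>
    funext fun j => (hγ.invariant (k + 1, j)).unique (hasSum_transition_succ γ k j)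
  have hlim : ∀ i, Tendsto (fun k => level γ k i) atTop (𝓝 0) := fun i =>
    (hγ.total.summable.comp_injective (Prod.mk_left_injective i)).tendsto_atTop_zero
  have hlim' : Tendsto (level γ) atTop (𝓝 0) := tendsto_pi_nhds.2 hlim
  refine sub_eq_zero.1 (eq_zero_of_recursion hℓ hp hpq hR
    (δ := fun k => level γ (k + 1) - level γ k ᵥ* R) (fun k => ?_) (fun i => ?_) k)
  · have h1 : level γ k ᵥ* R ᵥ* cofactor ℓ p R = -(level γ k ᵥ* blockUp ℓ p) := by
      rw [vecMul_vecMul, mul_cofactor hR.equation, vecMul_neg]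
    have h2 : level γ (k + 1) ᵥ* cofactor ℓ p R = level γ (k + 1) ᵥ* blockStay ℓ p
        - level γ (k + 1) + level γ (k + 1) ᵥ* R ᵥ* blockDown ℓ p := by
      rw [cofactor, vecMul_add, vecMul_sub, vecMul_one, vecMul_vecMul]
    rw [sub_vecMul, sub_vecMul, h1, h2]
    linear_combination -hbal k
  · have h1 : Tendsto (fun k => level γ (k + 1) - level γ k ᵥ* R) atTop
        (𝓝 (0 - (0 : Phase ℓ → ℝ) ᵥ* R)) :=
      (hlim'.comp (tendsto_add_atTop_nat 1)).sub
        (((continuous_id.matrix_vecMul continuous_const).tendsto _).comp hlim')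
    rw [zero_vecMul, sub_zero] at h1
    exact tendsto_pi_nhds.1 h1 i

/-- Matrix-geometric form of the stationary vector. -/
lemma IsStationary.eq_geometric (hℓ : 1 ≤ ℓ) (hp : 0 < p) (hpq : p < 1 - p)
    (hR : IsRateMatrix ℓ p R) (hγ : IsStationary ℓ p γ) :
    γ = (2 * ℓ : ℝ)⁻¹ • geometric R := by
  have hlev : ∀ k, level γ k = level γ 0 ᵥ* R ^ k := by
    intro k
    induction k with
    | zero => simp
    | succ k ih => rw [hγ.level_succ hℓ hp hpq hR, ih, vecMul_vecMul, pow_succ]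
  -- In terms of τ, with γ₀ = τ(I - R), the boundary balance says that τ is invariant under the
  -- cyclic shift, hence constant.
  obtain ⟨τ, hτ⟩ := vecMul_surjective_iff_isUnit.2
    ((isUnit_iff_isUnit_det _).2 (det_one_sub_ne_zero hR).isUnit) (level γ 0)
  have hbal : level γ 0 = level γ 0 ᵥ* blockBoundary ℓ p + level γ 1 ᵥ* blockDown ℓ p :=
    funext fun j => (hγ.invariant (0, j)).unique (hasSum_transition_zero γ j)
  have hτ0 : τ ᵥ* ((1 - R) * (blockDown ℓ p + cofactor ℓ p R)) = 0 := by
    change τ ᵥ* (1 - R) = level γ 0 at hτ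
    rw [← vecMul_vecMul, hτ, cofactor, vecMul_add, vecMul_add, vecMul_sub, vecMul_one,
      ← vecMul_vecMul, ← hγ.level_succ hℓ hp hpq hR 0]
    rw [blockBoundary, vecMul_add] at hbal
    linear_combination -hbal
  rw [factorization_one hR.equation, vecMul_pencil_eq_zero] at hτ0
  have hconst : τ = τ ⟨0, by omega⟩ • (1 : Phase ℓ → ℝ) :=
    kernel_unique one_ne_zero hτ0 (fun i => by simp) (i₀ := ⟨0, by omega⟩) (by simp)
  set c := τ ⟨0, by omega⟩
  have hγc : γ = c • geometric R := by
    ext ⟨k, i⟩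
    have h1 := congrFun (hlev k) i
    rw [← hτ] at h1
    change γ (k, i) = ((τ ᵥ* (1 - R)) ᵥ* R ^ k) i at h1
    rw [h1, hconst, smul_vecMul, smul_vecMul, vecMul_vecMul]
    rfl
  have htot : HasSum γ (c * (2 * ℓ)) := by
    rw [hγc]
    exact (hasSum_geometric hℓ hp hpq hR).mul_left c
  rw [hγc, eq_inv_of_mul_eq_one_left (htot.unique hγ.total)]

/-- Asymptotics of the marginal probabilities. -/
lemma marginal_isLittleO (hℓ : 1 ≤ ℓ) (hp : 0 < p) (hpq : p < 1 - p)
    (hR : IsRateMatrix ℓ p R) (hγ : IsStationary ℓ p γ) {v : Phase ℓ → ℝ}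
    (hv : IsRightEigenvector ℓ p R v) :
    (fun k : ℕ => marginal γ k - (1 - rho p ^ 2) / (2 * (ℓ : ℝ)) * (∑ i, v i)
      * (∑ i, uHat ℓ p i) * rho p ^ (2 * k)) =o[atTop] fun k : ℕ => rho p ^ (2 * k) := by
  obtain ⟨hv1, hv2⟩ := hv
  -- Split 1 = s v + (1 - s v): the first part carries the exact ρ^(2k) term, the second is
  -- orthogonal to û.
  set s := uHat ℓ p ⬝ᵥ 1 with hs
  have huw : uHat ℓ p ⬝ᵥ (1 - s • v) = 0 := by
    rw [dotProduct_sub, dotProduct_smul, hv2, ← hs]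
    simp
  have hlittle := (dotProduct_pow_isLittleO hℓ hp hpq hR ((1 : Phase ℓ → ℝ) ᵥ* (1 - R)) huw).const_mul_left
    (2 * ℓ : ℝ)⁻¹
  refine hlittle.congr_left fun k => ?_
  have hpow : ∀ k : ℕ, R ^ k *ᵥ v = rho p ^ (2 * k) • v := by
    intro k
    induction k with
    | zero => simp
    | succ k ih =>
      rw [pow_succ, ← mulVec_mulVec, hv1, mulVec_smul, ih, smul_smul]
      congr 1
      ring
  have hgv : ((1 : Phase ℓ → ℝ) ᵥ* (1 - R)) ⬝ᵥ v = (1 - rho p ^ 2) * ∑ i, v i := by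
    rw [← dotProduct_mulVec, sub_mulVec, one_mulVec, hv1, dotProduct_sub, dotProduct_smul,
      one_dotProduct, smul_eq_mul]
    ring
  have hs' : ∑ i, uHat ℓ p i = s := by rw [hs, dotProduct_one]
  have hmarg : marginal γ k
      = (2 * ℓ : ℝ)⁻¹ * (((1 : Phase ℓ → ℝ) ᵥ* (1 - R)) ᵥ* R ^ k) ⬝ᵥ 1 := by
    rw [hγ.eq_geometric hℓ hp hpq hR, vecMul_vecMul, dotProduct_one, Finset.mul_sum]
    rfl
  rw [hmarg, hs', dotProduct_sub, dotProduct_smul, ← dotProduct_mulVec _ _ v, hpow,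
    dotProduct_smul, hgv]
  simp only [smul_eq_mul]
  ring

end Stationary

end TrafficLight

end

theorem theorem3 (ℓ : ℕ) (hℓ : 1 ≤ ℓ) (p : ℝ) (hp : 0 < p) (hpq : p < 1 - p) :
    -- the rate matrix and the stationary probability vector exist and are unique
    (∃! R : Matrix (TrafficLight.Phase ℓ) (TrafficLight.Phase ℓ) ℝ,
      TrafficLight.IsRateMatrix ℓ p R) ∧
    (∃! γ : TrafficLight.State ℓ → ℝ, TrafficLight.IsStationary ℓ p γ) ∧
    (∃ σ μ : Fin ℓ → ℂ, TrafficLight.AreRoots ℓ p σ μ) ∧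
    ∀ R : Matrix (TrafficLight.Phase ℓ) (TrafficLight.Phase ℓ) ℝ,
      TrafficLight.IsRateMatrix ℓ p R →
      -- `ρ²` is a simple eigenvalue, all others being strictly smaller in modulus
      ((TrafficLight.rho p : ℂ) ^ 2 ∈ spectrum ℂ (TrafficLight.toComplex R) ∧
        (TrafficLight.toComplex R).charpoly.rootMultiplicity
          ((TrafficLight.rho p : ℂ) ^ 2) = 1 ∧
        ∀ z ∈ spectrum ℂ (TrafficLight.toComplex R),
          z ≠ (TrafficLight.rho p : ℂ) ^ 2 → ‖z‖ < TrafficLight.rho p ^ 2) ∧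
      -- its left eigenvector
      TrafficLight.uHat ℓ p ᵥ* R = TrafficLight.rho p ^ 2 • TrafficLight.uHat ℓ p ∧
      -- all the eigenvalues, with their multiplicities
      (∀ σ μ : Fin ℓ → ℂ, TrafficLight.AreRoots ℓ p σ μ →
        (TrafficLight.toComplex R).charpoly.roots =
          Multiset.replicate ℓ 0 + Finset.univ.val.map (fun j => 1 / μ j)) ∧
      -- the normalised right eigenvector
      (∃! v : TrafficLight.Phase ℓ → ℝ, TrafficLight.IsRightEigenvector ℓ p R v) ∧
      -- the asymptotics of the marginal stationary probability
      ∀ γ : TrafficLight.State ℓ → ℝ, TrafficLight.IsStationary ℓ p γ →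
        ∀ v : TrafficLight.Phase ℓ → ℝ, TrafficLight.IsRightEigenvector ℓ p R v →
          (fun k : ℕ => TrafficLight.marginal γ k
              - (1 - TrafficLight.rho p ^ 2) / (2 * (ℓ : ℝ)) * (∑ i, v i)
                * (∑ i, TrafficLight.uHat ℓ p i) * TrafficLight.rho p ^ (2 * k))
            =o[atTop] (fun k : ℕ => TrafficLight.rho p ^ (2 * k)) := by
  obtain ⟨R₀, hR₀, -⟩ := TrafficLight.exists_rateMatrix (ℓ := ℓ) hp hpq
  refine ⟨⟨R₀, hR₀, fun R hR => TrafficLight.rateMatrix_unique hℓ hp hpq hR hR₀⟩,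
    ⟨_, TrafficLight.isStationary_geometric hℓ hp hpq hR₀,
      fun γ hγ => hγ.eq_geometric hℓ hp hpq hR₀⟩,
    TrafficLight.exists_areRoots hp, fun R hR => ⟨TrafficLight.spectrum_rateMatrix hℓ hp hpq hR,
      TrafficLight.uHat_vecMul hℓ hp hpq hR,
      fun σ μ hr => TrafficLight.charpoly_roots hℓ hp hpq hR hr,
      TrafficLight.exists_unique_right_eigenvector hℓ hp hpq hR,
      fun γ hγ v hv => TrafficLight.marginal_isLittleO hℓ hp hpq hR hγ hv⟩⟩
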